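/- Let $\boldsymbol p,\boldsymbol q:\mathbb C\dashrightarrow\mathbb C^n$ have meromorphic components and admit rational inverses, i.e. there are rational functions $R_{\boldsymbol p},R_{\boldsymbol q}$ on $\mathbb C^n$, defined at generic points of the respective curves, with $R_{\boldsymbol p}(\boldsymbol p(z))=z$ and $R_{\boldsymbol q}(\boldsymbol q(z))=z$ for generic $z$. Let $C_1,C_2\subset\mathbb C^n$ be the curves that they parametrize: $C_1$ (resp. $C_2$) consists of all finite values (or limits) of $\boldsymbol p$ (resp. $\boldsymbol q$) at points of $\mathbb C\cup\{\infty\}$, where $\infty$ contributes only if the parametrization is rational and finite at $\infty$. Assume that neither $C_1$ nor $C_2$ is contained in an affine hyperplane. An affine equivalence between $C_1$ and $C_2$ is a map $f(\boldsymbol x)=A\boldsymbol x+\boldsymbol b$, with $A\in\mathbb C^{n\times n}$ nonsingular and $\boldsymbol b\in\mathbb C^n$, such that $f(C_1)=C_2$; if one exists, $C_1$ and $C_2$ are affinely equivalent. For a parametrization $\boldsymbol u$ put $D(\boldsymbol u)=[\boldsymbol u',\boldsymbol u'',\dots,\boldsymbol u^{(n)}]$ and $\Delta=\det D(\boldsymbol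 u)$. For $1\le i\le n$ let $I_i=A_i/\Delta$, where $A_i$ is obtained from $\Delta$ by replacing the column $\boldsymbol u^{(i)}$ with $\boldsymbol u^{(n+1)}$; let $I_{n+1}=-1$ and $I_0=\det[\boldsymbol u',\dots,\boldsymbol u^{(n-1)},\boldsymbol u^{(n+2)}]/\Delta$. Let $$\tilde B_{k,m}=\frac{1}{(n(n+1))^{k-m}}\binom{k-1}{m-1}\frac{k!}{m!}\quad(k\ge m\ge 1),\qquad \tilde B_{k,m}=0\quad(k<m),$$ and let $M_r^{n+1,i+1}$ be the determinant of the matrix with entries $\tilde B_{k,m}$, with rows $k=n+1,n,\dots,i+1$ and columns $m=n+1,n,\dots,i$, the column $m=i+r$ being omitted. Define $$F_1=\frac{I_0-\frac{n+2}{2n}I_n^2}{I_{n-1}+M_2^{n+1,n}I_n^2},\qquad F_{k-1}=\frac{\left(\sum_{i=0}^{k}M_i^{n+1,n-k+2}\,I_{n-k+1+i}\,I_n^{i}\right)^{e_k/k}}{\left(I_{n-1}+M_2^{n+1,n}I_n^2\right)^{e_k/2}}\quad(3\le k\le n),$$ with $e_k=\operatorname{lcm}(2,k)$, and write $F_j(\boldsymbol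 u)$ for $F_j$ formed from $\boldsymbol u$. Then $C_1$ and $C_2$ are affinely equivalent if and only if there is a Möbius transformation $\varphi(z)=\frac{az+b}{cz+d}$, $ad-bc\ne0$, such that 1. $F_j(\boldsymbol p)(z)=F_j(\boldsymbol q)(\varphi(z))$ for $j=1,\dots,n-1$ and generic $z$ (both sides being undefined is allowed, which happens when the denominators vanish identically); 2. $D(\boldsymbol q\circ\varphi)(z)\,D(\boldsymbol p)(z)^{-1}$ is a constant matrix $A$; 3. $\boldsymbol q(\varphi(z))-A\,\boldsymbol p(z)$ is a constant vector $\boldsymbol b$. Furthermore, for every such $\varphi$, with the corresponding $A$ and $\boldsymbol b$, the map $f(\boldsymbol x)=A\boldsymbol x+\boldsymbol b$ is an affine equivalence between $C_1$ and $C_2$. -/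

import Mathlib

open Filter Topology

noncomputable section

namespace AffineCurves

variable {n : ℕ}

/-! ## Curves, rational inverses, affine equivalence -/

/-- The curve in `ℂⁿ` parametrized by `p`: all (finite) points that are the value or limit of `p` at
a point of `ℂ ∪ {∞}`. At a regular point this is the value of `p`; poles contribute nothing. The
point `∞` can contribute only if `p` is a rational map that is regular at `∞`. The values of a
meromorphic map on a discrete closed set are immaterial, hence the filter `codiscrete ℂ`. -/
def curve (p : ℂ → Fin n → ℂ) : Set (Fin n → ℂ) :=
  {x | (∃ z : ℂ, Tendsto p (𝓝[≠] z) (𝓝 x)) ∨ Tendsto p (cocompact ℂ ⊓ codiscrete ℂ) (𝓝 x)}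

/-- All components of `p` are meromorphic on `ℂ`. -/
def MeromorphicComponents (p : ℂ → Fin n → ℂ) : Prop :=
  ∀ i, Meromorphic (fun z => p z i)

/-- There is a rational function `R / S` of `n` variables with `(R / S) (p z) = z`
for generic `z` (in particular it is defined at `p z` for generic `z`). -/
def HasRationalInverse (p : ℂ → Fin n → ℂ) : Prop :=
  ∃ R S : MvPolynomial (Fin n) ℂ, ∀ᶠ z in codiscrete ℂ,
    MvPolynomial.eval (p z) S ≠ 0 ∧ MvPolynomial.eval (p z) R / MvPolynomial.eval (p z) S = z

/-- The set `C` lies in some affine hyperplane `∑ aᵢ xᵢ = c`, `a ≠ 0`. -/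
def InHyperplane (C : Set (Fin n → ℂ)) : Prop :=
  ∃ (a : Fin n → ℂ) (c : ℂ), a ≠ 0 ∧ ∀ x ∈ C, ∑ i, a i * x i = c

/-- `x ↦ A x + b`, with `A` nonsingular, maps `C₁` onto `C₂`. -/
def IsAffineEquivalence (A : Matrix (Fin n) (Fin n) ℂ) (b : Fin n → ℂ)
    (C₁ C₂ : Set (Fin n → ℂ)) : Prop :=
  A.det ≠ 0 ∧ (fun x => A.mulVec x + b) '' C₁ = C₂

def AffinelyEquivalent (C₁ C₂ : Set (Fin n → ℂ)) : Prop :=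
  ∃ (A : Matrix (Fin n) (Fin n) ℂ) (b : Fin n → ℂ), IsAffineEquivalence A b C₁ C₂

/-- Coefficients of a Möbius transformation `z ↦ (a z + b) / (c z + d)`. -/
structure Moebius where
  a : ℂ
  b : ℂ
  c : ℂ
  d : ℂ
  det_ne_zero : a * d - b * c ≠ 0

namespace Moebius

/-- The set of points of `ℂ` which are not poles of the transformation. -/
def domain (φ : Moebius) : Set ℂ := {z | φ.c * z + φ.d ≠ 0}

def toFun (φ : Moebius) (z : ℂ) : ℂ := (φ.a * z + φ.b) / (φ.c * z + φ.d)

end Moebius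

/-! ## Derivative determinants and the affine invariants -/

/-- The matrix whose columns are the derivatives of `u` at `z` of orders `e 0, …, e (n - 1)`. -/
def derivMatrix (u : ℂ → Fin n → ℂ) (e : Fin n → ℕ) (z : ℂ) : Matrix (Fin n) (Fin n) ℂ :=
  Matrix.of fun r j => iteratedDeriv (e j) u z r

/-- `D(u) = [u', u'', …, u⁽ⁿ⁾]`. -/
def D (u : ℂ → Fin n → ℂ) (z : ℂ) : Matrix (Fin n) (Fin n) ℂ :=
  derivMatrix u (fun j => (j : ℕ) + 1) z

/-- `Δ(u) = det D(u)`. -/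
def Delta (u : ℂ → Fin n → ℂ) (z : ℂ) : ℂ := (D u z).det

/-- For `1 ≤ i ≤ n`, the determinant `A_i(u)` obtained from `Δ(u)` by replacing the column `u⁽ⁱ⁾`
with `u⁽ⁿ⁺¹⁾`. -/
def detA (u : ℂ → Fin n → ℂ) (i : ℕ) (z : ℂ) : ℂ :=
  (derivMatrix u (fun j => if (j : ℕ) + 1 = i then n + 1 else (j : ℕ) + 1) z).det

/-- `I_i(u) = A_i(u) / Δ(u)` for `1 ≤ i ≤ n`, with the convention `I_{n+1} = -1`. -/
def inv (u : ℂ → Fin n → ℂ) (i : ℕ) (z : ℂ) : ℂ :=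
  if i = n + 1 then -1 else detA u i z / Delta u z

/-- `I₀(u) = ‖u', …, u⁽ⁿ⁻¹⁾, u⁽ⁿ⁺²⁾‖ / Δ(u)`. -/
def invZero (u : ℂ → Fin n → ℂ) (z : ℂ) : ℂ :=
  (derivMatrix u (fun j => if (j : ℕ) + 1 = n then n + 2 else (j : ℕ) + 1) z).det / Delta u z

/-! ## The Möbius-commuting invariants -/

/-- The normalized Lah number `L(k,m) / (n (n + 1)) ^ (k - m)`,
`L(k,m) = (k-1 choose m-1) k! / m!`, for `m ≥ 1`; it is `0` for `k < m`. -/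
def lahB (n k m : ℕ) : ℂ :=
  if k < m then 0
  else ((k - 1).choose (m - 1) * k.factorial / m.factorial : ℂ) / ((n : ℂ) * (n + 1)) ^ (k - m)

/-- The determinant `M_r^{n+1,i+1}` of order `n + 1 - i`: its rows are indexed by `i + 1, …, n + 1`,
its columns by `i, …, n + 1` with `i + r` left out, and its entries are `lahB n row column`.
(Listing both rows and columns in decreasing order gives the same determinant.) -/
def lahM (n i r : ℕ) : ℂ :=
  (Matrix.of fun x y : Fin (n + 1 - i) =>
    lahB n (i + 1 + x) (if (y : ℕ) < r then i + y else i + y + 1)).det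

/-- `∑_{i=0}^{k} M_i^{n+1,n-k+2} I_{n-k+1+i} I_n^i`, for `2 ≤ k ≤ n`. -/
def weightSum (u : ℂ → Fin n → ℂ) (k : ℕ) (z : ℂ) : ℂ :=
  ∑ i ∈ Finset.range (k + 1), lahM n (n - k + 1) i * inv u (n - k + 1 + i) z * inv u n z ^ i

/-- `I_{n-1} + M_2^{n+1,n} I_n ^ 2`, some power of which is the denominator of each `F_j`. -/
def den (u : ℂ → Fin n → ℂ) (z : ℂ) : ℂ :=
  inv u (n - 1) z + lahM n (n - 1) 2 * inv u n z ^ 2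

/-- The Möbius-commuting invariants `F_1, …, F_{n-1}`:
`F_1 = (I₀ - (n+2)/(2n) I_n²) / den` and, for `3 ≤ k ≤ n`,
`F_{k-1} = weightSum k ^ (e/k) / den ^ (e/2)` with `e = lcm(2, k)`. -/
def F (u : ℂ → Fin n → ℂ) (j : ℕ) (z : ℂ) : ℂ :=
  if j = 1 then
    (invZero u z - ((n : ℂ) + 2) / (2 * n) * inv u n z ^ 2) / den u z
  else
    weightSum u (j + 1) z ^ (Nat.lcm 2 (j + 1) / (j + 1)) / den u z ^ (Nat.lcm 2 (j + 1) / 2)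

/-- `F_j(p)(z) = F_j(q)(φ(z))` for `j = 1, …, n - 1` and generic `z`, as an identity of partially
defined functions: either both sides are undefined (vanishing denominators) or both are defined
and equal. -/
def InvariantsMatch (p q : ℂ → Fin n → ℂ) (φ : Moebius) : Prop :=
  ∀ j ∈ Finset.Icc 1 (n - 1), ∀ᶠ z in codiscreteWithin φ.domain,
    (den p z = 0 ↔ den q (φ.toFun z) = 0) ∧ F p j z = F q j (φ.toFun z)

/-- The Möbius transformation `φ` satisfies `F_j(p)(z) = F_j(q)(φ(z))` for `j = 1, …, n - 1`,
`D(q ∘ φ) D(p)⁻¹` is the constant matrix `A`, and `q ∘ φ - A p` is the constant vector `b`. -/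
def Matches (p q : ℂ → Fin n → ℂ) (φ : Moebius) (A : Matrix (Fin n) (Fin n) ℂ)
    (b : Fin n → ℂ) : Prop :=
  InvariantsMatch p q φ ∧
  (∀ᶠ z in codiscreteWithin φ.domain, D (fun x => q (φ.toFun x)) z * (D p z)⁻¹ = A) ∧
  (∀ᶠ z in codiscreteWithin φ.domain, q (φ.toFun z) - A.mulVec (p z) = b)

end AffineCurves

end

/-! Suppose `f x = A x + b` maps `C₁` onto `C₂`. Composing `f ∘ p` with the rational inverse of `q`
gives a meromorphic `ψ` with `q ∘ ψ = f ∘ p` off a countable set, and `ψ` is injective off a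
countable set. Such a function is Möbius (`Moebius.exists_moebius_of_injOn` in spirit, here
`exists_moebius_of_injOn`): subtracting the principal part at `z₀` from `1 / (ψ - ψ z₀)` leaves a
bounded function, constant by Liouville.

Differentiating `q ∘ φ = A p + b` gives condition 2. For condition 1, the `I_i` are affine
invariants, being the coefficients that express `u⁽ⁿ⁺¹⁾` in the lower derivatives. Under `u ↦ u ∘ φ`
they change by a Lah matrix in `l = φ'` and `μ = φ'' / (2 φ')`, while `I_n` is scaled by `l` and
shifted by `n (n + 1) μ`. Normalized Lah matrices form a one-parameter group, so applying the one
with parameter `I_n` cancels the shift: `weightSum u k` is multiplied by `l ^ k`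
(`LahRelated.weightSum_eq`). Each `F_j` is a quotient of equal weights. All this needs `Δ ≠ 0`
generically, which holds because a vanishing Wronskian of `p'` would put `C₁` in a hyperplane.

Conversely, condition 3 says `q ∘ φ = f ∘ p` generically. As `φ` permutes the points of the sphere,
`f` carries limits of `p` to limits of `q`, in both directions once `A` is invertible; a singular
`A` would put `C₂` in a hyperplane. -/

noncomputable section

namespace AffineCurves

variable {n : ℕ}

/-! ### Lah numbers and the minors `lahM`. -/

/-- The (unsigned) Lah numbers, defined by their recurrence. -/
def lah : ℕ → ℕ → ℕ
  | 0, 0 => 1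
  | 0, _ + 1 => 0
  | _ + 1, 0 => 0
  | k + 1, m + 1 => (k + m + 1) * lah k (m + 1) + lah k m

theorem lah_zero_zero : lah 0 0 = 1 := by simp [lah]

theorem lah_zero_succ (m : ℕ) : lah 0 (m + 1) = 0 := by simp [lah]

theorem lah_succ_zero (k : ℕ) : lah (k + 1) 0 = 0 := by simp [lah]

theorem lah_succ_succ (k m : ℕ) :
    lah (k + 1) (m + 1) = (k + m + 1) * lah k (m + 1) + lah k m := by simp [lah]

theorem lah_eq_zero_of_lt {k m : ℕ} (h : k < m) : lah k m = 0 := by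
  induction k generalizing m with
  | zero =>
    obtain ⟨m, rfl⟩ := Nat.exists_eq_succ_of_ne_zero h.ne'
    exact lah_zero_succ m
  | succ k ih =>
    obtain ⟨m, rfl⟩ := Nat.exists_eq_succ_of_ne_zero (Nat.ne_zero_of_lt h)
    rw [Nat.succ_eq_add_one, lah_succ_succ, ih (by omega), ih (by omega)]
    simp

theorem lah_self (k : ℕ) : lah k k = 1 := by
  induction k with
  | zero => exact lah_zero_zero
  | succ k ih => rw [lah_succ_succ, ih, lah_eq_zero_of_lt (Nat.lt_succ_self k), mul_zero,
    zero_add]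

theorem lah_mul_factorial (k m : ℕ) :
    lah (k + 1) (m + 1) * (m + 1).factorial = k.choose m * (k + 1).factorial := by
  induction k generalizing m with
  | zero =>
    cases m with
    | zero => simp [lah]
    | succ m => simp [lah]
  | succ k ih =>
    cases m with
    | zero =>
      have h := ih 0
      rw [lah_succ_succ, lah_succ_zero, Nat.factorial_succ (k + 1)]
      simp only [zero_add, Nat.factorial_one, mul_one, Nat.choose_zero_right, one_mul] at h ⊢
      rw [h]
      ring
    | succ m =>
      have h1 := ih m
      have h2 := ih (m + 1)
      have h3 : (m + 1) * k.choose (m + 1) + m * k.choose m = k * k.choose m := by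
        have := Nat.choose_succ_right_eq k m
        rcases le_or_gt m k with h | h
        · obtain ⟨d, rfl⟩ := Nat.exists_eq_add_of_le h
          rw [Nat.add_sub_cancel_left] at this
          linarith
        · simp [Nat.choose_eq_zero_of_lt h, Nat.choose_eq_zero_of_lt (h.trans (Nat.lt_succ_self m))]
      rw [lah_succ_succ, add_mul, Nat.choose_succ_succ, Nat.factorial_succ (k + 1),
        mul_assoc, h2, Nat.factorial_succ (m + 1),
        show lah (k + 1) (m + 1) * ((m + 1 + 1) * (m + 1).factorial)
          = (m + 2) * (lah (k + 1) (m + 1) * (m + 1).factorial) by ring, h1]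
      simp only [Nat.succ_eq_add_one]
      linear_combination (k + 1).factorial * h3

theorem lahB_eq_zero_of_lt (n : ℕ) {k m : ℕ} (h : k < m) : lahB n k m = 0 := by
  simp [lahB, h]

theorem lahB_mul_pow {n k m : ℕ} (hn : n ≠ 0) (hm : m ≠ 0) :
    lahB n k m * ((n : ℂ) * (n + 1)) ^ (k - m) = lah k m := by
  rcases lt_or_ge k m with h | h
  · simp [lahB_eq_zero_of_lt n h, lah_eq_zero_of_lt h]
  · have hn' : ((n : ℂ) * (n + 1)) ≠ 0 := by exact_mod_cast (by positivity : n * (n + 1) ≠ 0)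
    obtain ⟨m, rfl⟩ := Nat.exists_eq_succ_of_ne_zero hm
    obtain ⟨k, rfl⟩ := Nat.exists_eq_succ_of_ne_zero (by omega : k ≠ 0)
    have hf : ((m + 1).factorial : ℂ) ≠ 0 := by exact_mod_cast (m + 1).factorial_ne_zero
    have h2 : (lah (k + 1) (m + 1) : ℂ) * (m + 1).factorial = k.choose m * (k + 1).factorial := by
      exact_mod_cast lah_mul_factorial k m
    rw [lahB, if_neg (by omega), div_mul_cancel₀ _ (pow_ne_zero _ hn')]
    simp only [Nat.succ_eq_add_one, Nat.add_sub_cancel]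
    rw [div_eq_iff hf, h2]

theorem lahB_self (n m : ℕ) : lahB n m m = 1 := by
  have hf : (m.factorial : ℂ) ≠ 0 := by exact_mod_cast m.factorial_ne_zero
  simp [lahB, hf]

/-- The factorials telescope and the binomials satisfy the subset-of-a-subset identity. This reduces
the group law of Lah matrices to the binomial theorem. -/
theorem lahB_mul_lahB (n : ℕ) {m : ℕ} (hm : m ≠ 0) {i d : ℕ} (hi : i ≤ d) :
    lahB n (m + d) (m + i) * lahB n (m + i) m = lahB n (m + d) m * d.choose i := by
  obtain ⟨m, rfl⟩ := Nat.exists_eq_succ_of_ne_zero hm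
  have hf : ((m + 1).factorial : ℂ) ≠ 0 := by exact_mod_cast (m + 1).factorial_ne_zero
  have hf2 : ((m + 1 + i).factorial : ℂ) ≠ 0 := by exact_mod_cast (m + 1 + i).factorial_ne_zero
  have hc : ((m + d).choose (m + i) * (m + i).choose m : ℂ) = (m + d).choose m * d.choose i := by
    have := Nat.choose_mul (n := m + d) (k := m + i) (s := m) (by omega)
    rw [Nat.add_sub_cancel_left, Nat.add_sub_cancel_left] at this
    exact_mod_cast this
  rw [lahB, lahB, lahB, if_neg (by omega), if_neg (by omega), if_neg (by omega)]
  simp only [Nat.succ_eq_add_one, show m + 1 + d - (m + 1 + i) = d - i by omega,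
    show m + 1 + i - (m + 1) = i by omega, show m + 1 + d - (m + 1) = d by omega,
    show m + 1 + d - 1 = m + d by omega, show m + 1 + i - 1 = m + i by omega,
    Nat.add_sub_cancel]
  rw [div_mul_div_comm, ← pow_add, Nat.sub_add_cancel hi, div_mul_eq_mul_div _ (_ ^ d)]
  congr 1
  field_simp
  linear_combination ((m + 1 + d).factorial : ℂ) * hc

/-- The normalized Lah matrices form a one-parameter group. -/
theorem sum_lahB_mul_lahB (n : ℕ) {m : ℕ} (hm : m ≠ 0) (d : ℕ) (s t : ℂ) :
    ∑ i ∈ Finset.range (d + 1),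
      lahB n (m + d) (m + i) * lahB n (m + i) m * (s ^ (d - i) * t ^ i)
      = lahB n (m + d) m * (s + t) ^ d := by
  rw [add_comm s t, add_pow, Finset.mul_sum]
  refine Finset.sum_congr rfl fun i hi => ?_
  rw [lahB_mul_lahB n hm (by simpa [Nat.lt_succ_iff] using hi)]
  ring

/-- `lahM` is a minor of a unitriangular matrix `B`, hence up to sign an entry of `B⁻¹`. By the
group law, inverting `B` only changes the parameter `1` to `-1`, that is, the signs of the entries.
-/
theorem lahM_eq_lahB {n m r : ℕ} (hm : m ≠ 0) (hr : r ≤ n + 1 - m) :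
    lahM n m r = lahB n (m + r) m := by
  set N := n + 1 - m with hN
  let B : Matrix (Fin (N + 1)) (Fin (N + 1)) ℂ := Matrix.of fun x y => lahB n (m + x) (m + y)
  let v : Fin (N + 1) → ℂ := fun y => lahB n (m + y) m * (-1) ^ (y : ℕ)
  have hdet : B.det = 1 := by
    rw [Matrix.det_of_isLowerTriangular]
    · simp only [B, Matrix.of_apply]
      exact Finset.prod_eq_one fun i _ => lahB_self n _
    · intro i j hij
      exact lahB_eq_zero_of_lt n (by simpa using hij)
  -- `v` is the first column of the matrix with parameter `-1`; the group law gives `(1 - 1) ^ x`.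
  have hBv : B.mulVec v = Pi.single 0 1 := by
    ext x
    have h1 : B.mulVec v x = ∑ i ∈ Finset.range (N + 1),
        lahB n (m + x) (m + i) * lahB n (m + i) m * (1 ^ ((x : ℕ) - i) * (-1) ^ i) := by
      rw [← Fin.sum_univ_eq_sum_range
        (fun i => lahB n (m + x) (m + i) * lahB n (m + i) m * (1 ^ ((x : ℕ) - i) * (-1) ^ i))]
      simp only [Matrix.mulVec, dotProduct, B, v, Matrix.of_apply, one_pow, one_mul, mul_assoc]
    have h2 : ∑ i ∈ Finset.range (N + 1),
        lahB n (m + x) (m + i) * lahB n (m + i) m * ((1 : ℂ) ^ ((x : ℕ) - i) * (-1) ^ i)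
        = ∑ i ∈ Finset.range ((x : ℕ) + 1),
        lahB n (m + x) (m + i) * lahB n (m + i) m * ((1 : ℂ) ^ ((x : ℕ) - i) * (-1) ^ i) := by
      symm
      apply Finset.sum_subset
      · intro i hi
        have := x.2
        simp only [Finset.mem_range] at hi ⊢
        omega
      · intro i _ hi
        rw [lahB_eq_zero_of_lt n (by simp only [Finset.mem_range] at hi; omega)]
        ring
    rw [h1, h2, sum_lahB_mul_lahB n hm]
    by_cases hx : x = 0
    · subst hx
      simp [lahB_self n]
    · have : (x : ℕ) ≠ 0 := fun h => hx (Fin.ext h)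
      simp [hx, this]
  have hadj : B.adjugate.mulVec (Pi.single 0 1) = v := by
    rw [← hBv, Matrix.mulVec_mulVec, Matrix.adjugate_mul, hdet, one_smul, Matrix.one_mulVec]
  have h3 := congrFun hadj ⟨r, by omega⟩
  rw [Matrix.mulVec_single_one, Matrix.col_apply, Matrix.adjugate_fin_succ_eq_det_submatrix] at h3
  simp only [v, Fin.val_zero, zero_add] at h3
  have h4 : (B.submatrix (Fin.succAbove 0) (Fin.succAbove ⟨r, by omega⟩)).det = lahM n m r := by
    unfold lahM
    congr 1
    ext x y
    simp only [Matrix.submatrix_apply, B, Matrix.of_apply, Fin.succAbove_zero, Fin.val_succ]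
    congr 1
    · omega
    · by_cases hy : (y : ℕ) < r
      · rw [Fin.succAbove_of_castSucc_lt _ _ (by simpa [Fin.lt_def] using hy), if_pos hy]
        simp
      · rw [Fin.succAbove_of_le_castSucc _ _ (by simpa [Fin.le_def] using hy), if_neg hy]
        simp [add_assoc]
  rw [h4] at h3
  have h5 : ((-1 : ℂ) ^ r) * (-1) ^ r = 1 := by rw [← mul_pow]; simp
  linear_combination (-1 : ℂ) ^ r * h3 + (lahB n (m + r) m - lahM n m r) * h5

theorem lah_succ_self (k : ℕ) : lah (k + 1) k = k * (k + 1) := by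
  induction k with
  | zero => simp [lah]
  | succ k ih => rw [lah_succ_succ, ih, lah_self]; ring

theorem two_mul_lah_add_two (k : ℕ) : 2 * lah (k + 2) k = k * (k + 1) ^ 2 * (k + 2) := by
  induction k with
  | zero => simp [lah]
  | succ k ih => rw [lah_succ_succ, lah_succ_self, mul_add, ih]; ring

/-! ### The invariants as coordinates in the basis of derivatives. -/

/-- Cramer's rule. If `M.det = 0`, both sides are `0` by convention. -/
theorem inv_mulVec_eq_cramer_div (M : Matrix (Fin n) (Fin n) ℂ) (x : Fin n → ℂ) (i : Fin n) :
    (M⁻¹.mulVec x) i = (M.updateCol i x).det / M.det := by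
  rw [Matrix.inv_def, Matrix.smul_mulVec, ← Matrix.cramer_eq_adjugate_mulVec, Pi.smul_apply,
    Matrix.cramer_apply, Ring.inverse_eq_inv', smul_eq_mul, div_eq_inv_mul]

theorem inv_succ_eq (u : ℂ → Fin n → ℂ) (z : ℂ) {i : ℕ} (hi : i < n) :
    inv u (i + 1) z = ((D u z)⁻¹.mulVec (iteratedDeriv (n + 1) u z)) ⟨i, hi⟩ := by
  rw [inv_mulVec_eq_cramer_div, inv, if_neg (by omega), detA, Delta]
  congr 2
  ext r j
  simp only [derivMatrix, D, Matrix.of_apply, Matrix.updateCol_apply, Fin.ext_iff]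
  by_cases h : (j : ℕ) = i <;> simp [h]

theorem inv_add_one (u : ℂ → Fin n → ℂ) (z : ℂ) : inv u (n + 1) z = -1 := by
  simp [inv]

theorem invZero_eq (u : ℂ → Fin n → ℂ) (z : ℂ) {i : ℕ} (hi : i < n) (hn : i + 1 = n) :
    invZero u z = ((D u z)⁻¹.mulVec (iteratedDeriv (n + 2) u z)) ⟨i, hi⟩ := by
  rw [inv_mulVec_eq_cramer_div, invZero, Delta]
  congr 2
  ext r j
  simp only [derivMatrix, D, Matrix.of_apply, Matrix.updateCol_apply, Fin.ext_iff]
  by_cases h : (j : ℕ) = i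
  · simp [h, hn]
  · rw [if_neg (by omega), if_neg h]

theorem D_mulVec (u : ℂ → Fin n → ℂ) (z : ℂ) (c : ℕ → ℂ) :
    (D u z).mulVec (fun i => c i) = ∑ i ∈ Finset.range n, c i • iteratedDeriv (i + 1) u z := by
  rw [← Fin.sum_univ_eq_sum_range (fun i => c i • iteratedDeriv (i + 1) u z)]
  ext r
  simp [Matrix.mulVec, dotProduct, D, derivMatrix, Finset.sum_apply, mul_comm]

/-- The linear relation between the derivatives of orders `1, …, n + 1`. -/
theorem sum_inv_smul_iteratedDeriv {u : ℂ → Fin n → ℂ} {z : ℂ} (h : Delta u z ≠ 0) :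
    ∑ i ∈ Finset.range (n + 1), inv u (i + 1) z • iteratedDeriv (i + 1) u z = 0 := by
  rw [Finset.sum_range_succ, inv_add_one, ← D_mulVec u z (fun i => inv u (i + 1) z)]
  have : (fun i : Fin n => inv u (i + 1) z)
      = (D u z)⁻¹.mulVec (iteratedDeriv (n + 1) u z) := by
    ext i
    exact inv_succ_eq u z i.2
  rw [this, Matrix.mulVec_mulVec, Matrix.mul_nonsing_inv _ (isUnit_iff_ne_zero.2 h),
    Matrix.one_mulVec]
  simp

theorem eq_zero_of_sum_smul_iteratedDeriv {u : ℂ → Fin n → ℂ} {z : ℂ} (h : Delta u z ≠ 0)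
    {c : ℕ → ℂ} (hc : ∑ i ∈ Finset.range n, c i • iteratedDeriv (i + 1) u z = 0)
    {i : ℕ} (hi : i < n) : c i = 0 := by
  rw [← D_mulVec] at hc
  exact congrFun (Matrix.eq_zero_of_mulVec_eq_zero h hc) ⟨i, hi⟩

/-! ### Behaviour of the invariants under a Möbius change of parameter. -/

/-- At the points `z` and `w`, the derivatives of `v` and `u` of orders `1, …, n + 2` are related as
for `v = u ∘ φ` with `φ z = w` and `φ⁽ᵏ⁾(z) = k! l μ ^ (k - 1)`. -/
def LahRelated (u v : ℂ → Fin n → ℂ) (w z l μ : ℂ) : Prop :=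
  ∀ k ≤ n + 1, iteratedDeriv (k + 1) v z = ∑ m ∈ Finset.range (n + 2),
    ((lah (k + 1) (m + 1) : ℂ) * l ^ (m + 1) * μ ^ (k - m)) • iteratedDeriv (m + 1) u w

/-- The matrix expressing the derivatives of `u ∘ φ` in terms of those of `u`. -/
def lahMatrix (n : ℕ) (l μ : ℂ) : Matrix (Fin n) (Fin n) ℂ :=
  Matrix.of fun j k => (lah (k + 1) (j + 1) : ℂ) * l ^ ((j : ℕ) + 1) * μ ^ ((k : ℕ) - j)

namespace LahRelated

variable {u v : ℂ → Fin n → ℂ} {w z l μ : ℂ}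

theorem iteratedDeriv_eq (h : LahRelated u v w z l μ) {k N : ℕ} (hk : k < N) (hN : N ≤ n + 2) :
    iteratedDeriv (k + 1) v z = ∑ m ∈ Finset.range N,
      ((lah (k + 1) (m + 1) : ℂ) * l ^ (m + 1) * μ ^ (k - m)) • iteratedDeriv (m + 1) u w := by
  rw [h k (by omega)]
  symm
  apply Finset.sum_subset
  · intro i hi
    simp only [Finset.mem_range] at hi ⊢
    omega
  · intro i _ hi
    simp only [Finset.mem_range, not_lt] at hi
    rw [lah_eq_zero_of_lt (by omega)]
    simp

theorem D_eq (h : LahRelated u v w z l μ) : D v z = D u w * lahMatrix n l μ := by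
  ext r k
  have h1 := congrFun (h.iteratedDeriv_eq (N := n) k.2 (by omega)) r
  rw [← D_mulVec u w (fun m => (lah (k + 1) (m + 1) : ℂ) * l ^ (m + 1) * μ ^ ((k : ℕ) - m))] at h1
  exact h1

theorem det_lahMatrix (n : ℕ) (l μ : ℂ) :
    (lahMatrix n l μ).det = ∏ i : Fin n, l ^ ((i : ℕ) + 1) := by
  rw [Matrix.det_of_isUpperTriangular]
  · simp [lahMatrix, lah_self]
  · intro i j hij
    have : (j : ℕ) < i := hij
    simp [lahMatrix, lah_eq_zero_of_lt (show (j : ℕ) + 1 < i + 1 by omega)]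

theorem delta_ne_zero_iff (h : LahRelated u v w z l μ) (hl : l ≠ 0) :
    Delta v z ≠ 0 ↔ Delta u w ≠ 0 := by
  have : ∏ i : Fin n, l ^ ((i : ℕ) + 1) ≠ 0 :=
    Finset.prod_ne_zero_iff.2 fun i _ => pow_ne_zero _ hl
  rw [Delta, h.D_eq, Matrix.det_mul, det_lahMatrix, mul_ne_zero_iff, Delta]
  exact and_iff_left this

/-- Inserting the expansions of the derivatives of `v` into the linear relation for `v` gives a
relation between `u', …, u⁽ⁿ⁺¹⁾`. Its last coefficient is `-l ^ (n + 1)`, so it is `l ^ (n + 1)`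
times the relation for `u`. -/
theorem sum_lah_mul_inv (h : LahRelated u v w z l μ) (hl : l ≠ 0) (hu : Delta u w ≠ 0)
    {m : ℕ} (hm : m ≤ n) :
    ∑ k ∈ Finset.range (n + 1), (lah (k + 1) (m + 1) : ℂ) * μ ^ (k - m) * inv v (k + 1) z
      = l ^ (n - m) * inv u (m + 1) w := by
  rcases hm.eq_or_lt with rfl | hm
  · rw [Finset.sum_range_succ, Finset.sum_eq_zero]
    · simp [lah_self, inv_add_one]
    · intro k hk
      rw [lah_eq_zero_of_lt (by simpa using hk)]
      simp
  have hv := (h.delta_ne_zero_iff hl).2 hu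
  have h1 := sum_inv_smul_iteratedDeriv hv
  have h2 := sum_inv_smul_iteratedDeriv hu
  have h3 : ∑ k ∈ Finset.range (n + 1), inv v (k + 1) z • iteratedDeriv (k + 1) v z
      = ∑ m ∈ Finset.range (n + 1), (l ^ (m + 1) * ∑ k ∈ Finset.range (n + 1),
        (lah (k + 1) (m + 1) : ℂ) * μ ^ (k - m) * inv v (k + 1) z) • iteratedDeriv (m + 1) u w := by
    simp_rw [Finset.mul_sum, Finset.sum_smul]
    rw [Finset.sum_comm]
    refine Finset.sum_congr rfl fun k hk => ?_
    rw [h.iteratedDeriv_eq (N := n + 1) (by simpa using hk) (by omega), Finset.smul_sum]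
    refine Finset.sum_congr rfl fun m _ => ?_
    rw [smul_smul]
    congr 1
    ring
  set S : ℕ → ℂ := fun m => ∑ k ∈ Finset.range (n + 1),
    (lah (k + 1) (m + 1) : ℂ) * μ ^ (k - m) * inv v (k + 1) z with hS
  have hSn : S n = -1 := by
    simp only [hS]
    rw [Finset.sum_range_succ, Finset.sum_eq_zero]
    · simp [lah_self, inv_add_one]
    · intro k hk
      rw [lah_eq_zero_of_lt (by simpa using hk)]
      simp
  have h4 : ∑ m ∈ Finset.range n, (l ^ (m + 1) * S m - l ^ (n + 1) * inv u (m + 1) w) •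
      iteratedDeriv (m + 1) u w = 0 := by
    have h5 : ∑ m ∈ Finset.range (n + 1), (l ^ (m + 1) * S m - l ^ (n + 1) * inv u (m + 1) w) •
      iteratedDeriv (m + 1) u w = 0 := by
      simp_rw [sub_smul, mul_smul (l ^ (n + 1)), Finset.sum_sub_distrib, ← Finset.smul_sum]
      rw [h2, ← h3, h1]
      simp
    rw [Finset.sum_range_succ, hSn, inv_add_one] at h5
    simpa using h5
  have h6 := eq_zero_of_sum_smul_iteratedDeriv hu
    (c := fun m => l ^ (m + 1) * S m - l ^ (n + 1) * inv u (m + 1) w) h4 hm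
  have h7 : l ^ (n + 1) = l ^ (m + 1) * l ^ (n - m) := by
    rw [← pow_add]
    congr 1
    omega
  have h8 : l ^ (m + 1) * (S m - l ^ (n - m) * inv u (m + 1) w) = 0 := by
    simp only [h7] at h6
    linear_combination h6
  exact sub_eq_zero.1 ((mul_eq_zero.1 h8).resolve_left (pow_ne_zero _ hl))

/-- The shift is `lah (n + 1) n * μ`, which explains the normalization of `lahB` by powers of `n (n
+ 1)`. -/
theorem inv_self (h : LahRelated u v w z l μ) (hl : l ≠ 0) (hu : Delta u w ≠ 0) (hn : n ≠ 0) :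
    inv v n z - n * (n + 1) * μ = l * inv u n w := by
  obtain ⟨m, rfl⟩ := Nat.exists_eq_succ_of_ne_zero hn
  have h1 := h.sum_lah_mul_inv hl hu (m := m) (by omega)
  rw [Finset.sum_range_succ, Finset.sum_range_succ, Finset.sum_eq_zero] at h1
  · simp only [Nat.succ_eq_add_one] at h1 ⊢
    rw [lah_self, lah_succ_self, inv_add_one] at h1
    simp only [Nat.sub_self, Nat.add_sub_cancel_left] at h1
    push_cast at h1 ⊢
    linear_combination h1
  · intro k hk
    rw [lah_eq_zero_of_lt (by simpa using hk)]
    simp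

theorem weightSum_eq_sum_lahB (u : ℂ → Fin n → ℂ) (z : ℂ) {m k : ℕ} (hm : m ≠ 0)
    (hmk : m + k = n + 1) :
    weightSum u k z = ∑ i ∈ Finset.range (k + 1),
      lahB n (m + i) m * inv u (m + i) z * inv u n z ^ i := by
  have : n - k + 1 = m := by omega
  rw [weightSum, this]
  refine Finset.sum_congr rfl fun i hi => ?_
  rw [Finset.mem_range] at hi
  rw [lahM_eq_lahB hm (by omega)]

/-- `weightSum u k` is a coordinate of the Lah matrix with parameter `I_n(u)` applied to the vector
of the `I_i(u)`. For `v`, the parameter `I_n(v) = ν + l I_n(u)` splits by the group law, and the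
factor with parameter `ν` turns the `I_i(v)` into rescaled `I_i(u)`. -/
theorem weightSum_eq (h : LahRelated u v w z l μ) (hl : l ≠ 0) (hu : Delta u w ≠ 0)
    {k : ℕ} (hk : k ≤ n) (hn : n ≠ 0) : weightSum v k z = l ^ k * weightSum u k w := by
  obtain ⟨m, hmk⟩ : ∃ m, m + 1 + k = n + 1 := ⟨n - k, by omega⟩
  set ν : ℂ := n * (n + 1) * μ with hν
  have hJ := h.inv_self hl hu hn
  rw [← hν] at hJ
  have hJi : ∀ i ∈ Finset.range (k + 1), l ^ (k - i) * inv u (m + 1 + i) w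
      = ∑ d ∈ Finset.range (k + 1),
        lahB n (m + 1 + d) (m + 1 + i) * ν ^ (d - i) * inv v (m + 1 + d) z := by
    intro i hi
    rw [Finset.mem_range] at hi
    have h1 := h.sum_lah_mul_inv hl hu (m := m + i) (by omega)
    rw [show n - (m + i) = k - i by omega, show m + i + 1 = m + 1 + i by ring] at h1
    rw [← h1, show n + 1 = m + (k + 1) by omega, Finset.sum_range_add, Finset.sum_eq_zero, zero_add]
    · refine Finset.sum_congr rfl fun d _ => ?_
      rw [← lahB_mul_pow hn (by omega), hν, mul_pow ((n : ℂ) * (n + 1)) μ]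
      rw [show m + d + 1 = m + 1 + d by ring, show m + d - (m + i) = d - i by omega,
        show m + 1 + d - (m + 1 + i) = d - i by omega]
      ring
    · intro d hd
      rw [Finset.mem_range] at hd
      rw [lah_eq_zero_of_lt (by omega)]
      simp
  rw [weightSum_eq_sum_lahB v z (Nat.succ_ne_zero m) hmk,
    weightSum_eq_sum_lahB u w (Nat.succ_ne_zero m) hmk]
  have h2 : l ^ k * ∑ i ∈ Finset.range (k + 1),
      lahB n (m + 1 + i) (m + 1) * inv u (m + 1 + i) w * inv u n w ^ i
      = ∑ i ∈ Finset.range (k + 1), ∑ d ∈ Finset.range (k + 1),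
        lahB n (m + 1 + d) (m + 1 + i) * lahB n (m + 1 + i) (m + 1) *
          (ν ^ (d - i) * (l * inv u n w) ^ i) * inv v (m + 1 + d) z := by
    rw [Finset.mul_sum]
    refine Finset.sum_congr rfl fun i hi => ?_
    have h3 : l ^ k = l ^ (k - i) * l ^ i := by
      rw [← pow_add]
      congr 1
      rw [Finset.mem_range] at hi
      omega
    calc l ^ k * (lahB n (m + 1 + i) (m + 1) * inv u (m + 1 + i) w * inv u n w ^ i)
        = lahB n (m + 1 + i) (m + 1) * (l * inv u n w) ^ i *
          (l ^ (k - i) * inv u (m + 1 + i) w) := by rw [h3]; ring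
      _ = _ := by
        rw [hJi i hi, Finset.mul_sum]
        exact Finset.sum_congr rfl fun d _ => by ring
  -- The inner sum over `i` is now the group law with `s = ν` and `t = l I_n(u)`.
  rw [h2, Finset.sum_comm]
  refine Finset.sum_congr rfl fun d hd => ?_
  rw [← Finset.sum_mul]
  have h4 : ∑ i ∈ Finset.range (k + 1), lahB n (m + 1 + d) (m + 1 + i) *
      lahB n (m + 1 + i) (m + 1) * (ν ^ (d - i) * (l * inv u n w) ^ i)
      = ∑ i ∈ Finset.range (d + 1), lahB n (m + 1 + d) (m + 1 + i) *
      lahB n (m + 1 + i) (m + 1) * (ν ^ (d - i) * (l * inv u n w) ^ i) := by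
    symm
    apply Finset.sum_subset
    · intro i hi
      simp only [Finset.mem_range] at hi hd ⊢
      omega
    · intro i _ hi
      simp only [Finset.mem_range, not_lt] at hi
      rw [lahB_eq_zero_of_lt n (by omega)]
      ring
  rw [h4, sum_lahB_mul_lahB n (Nat.succ_ne_zero m), ← hJ]
  ring

/-- The terms `i = 1, 2` are both multiples of `I_n²`, the latter negative because `I_{n+1} = -1`.
They combine since `lahB n n (n - 1) = 2 * lahB n (n + 1) (n - 1)`. -/
theorem den_eq_weightSum (hn : 2 ≤ n) (u : ℂ → Fin n → ℂ) (z : ℂ) :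
    den u z = weightSum u 2 z := by
  obtain ⟨m, rfl⟩ : ∃ m, n = m + 1 + 1 := ⟨n - 2, by omega⟩
  rw [weightSum_eq_sum_lahB u z (Nat.succ_ne_zero m) rfl, den, show m + 1 + 1 - 1 = m + 1 by omega,
    lahM_eq_lahB (by omega) (by omega)]
  have ht : ((m + 1 + 1 : ℕ) : ℂ) * ((m + 1 + 1 : ℕ) + 1) ≠ 0 := by
    exact_mod_cast (by positivity : (m + 1 + 1) * (m + 1 + 1 + 1) ≠ 0)
  have h1 := lahB_mul_pow (n := m + 1 + 1) (k := m + 1 + 1) (m := m + 1) (by omega) (by omega)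
  have h2 := lahB_mul_pow (n := m + 1 + 1) (k := m + 1 + 2) (m := m + 1) (by omega) (by omega)
  have h3 : ((2 * lah (m + 1 + 2) (m + 1) : ℕ) : ℂ)
    = (((m + 1) * (m + 1 + 1) ^ 2 * (m + 1 + 2) : ℕ) : ℂ) := by rw [two_mul_lah_add_two]
  rw [lah_succ_self] at h1
  rw [show m + 1 + 1 - (m + 1) = 1 by omega] at h1
  rw [show m + 1 + 2 - (m + 1) = 2 by omega] at h2
  have h4 : lahB (m + 1 + 1) (m + 1 + 1) (m + 1) = 2 * lahB (m + 1 + 1) (m + 1 + 2) (m + 1) := by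
    apply mul_right_cancel₀ (pow_ne_zero 2 ht)
    rw [mul_assoc, h2]
    push_cast at h1 h3 ht ⊢
    rw [h3]
    linear_combination ((m : ℂ) + 1 + 1) * (m + 1 + 1 + 1) * h1
  simp only [Finset.sum_range_succ, Finset.sum_range_zero, Nat.succ_eq_add_one, add_zero,
    lahB_self]
  rw [show m + 1 + 2 = m + 1 + 1 + 1 by ring] at h4 ⊢
  rw [h4, inv_add_one]
  ring

theorem den_eq (h : LahRelated u v w z l μ) (hl : l ≠ 0) (hu : Delta u w ≠ 0)
    (hn : 2 ≤ n) : den v z = l ^ 2 * den u w := by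
  rw [den_eq_weightSum hn, den_eq_weightSum hn, h.weightSum_eq hl hu hn (by omega)]

/-- Compare the last coordinates of `v⁽ⁿ⁺²⁾` in the bases `D v z` and `D u w`. By triangularity the
last row of `lahMatrix` is only its diagonal entry `l ^ n`. -/
theorem invZero_eq (h : LahRelated u v w z l μ) (hl : l ≠ 0) (hu : Delta u w ≠ 0) (hn : n ≠ 0) :
    invZero v z = l ^ 2 * invZero u w + (n + 1) * (n + 2) * l * μ * inv u n w
      + lah (n + 2) n * μ ^ 2 := by
  obtain ⟨m, rfl⟩ := Nat.exists_eq_succ_of_ne_zero hn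
  simp only [Nat.succ_eq_add_one] at *
  have hv := (h.delta_ne_zero_iff hl).2 hu
  have hU : (D u w)⁻¹ * D u w = 1 := Matrix.nonsing_inv_mul _ (isUnit_iff_ne_zero.2 hu)
  have hV : D v z * (D v z)⁻¹ = 1 := Matrix.mul_nonsing_inv _ (isUnit_iff_ne_zero.2 hv)
  have h1 : (lahMatrix (m + 1) l μ).mulVec ((D v z)⁻¹.mulVec (iteratedDeriv (m + 1 + 2) v z))
      = (D u w)⁻¹.mulVec (iteratedDeriv (m + 1 + 2) v z) := by
    rw [Matrix.mulVec_mulVec, ← Matrix.one_mul (lahMatrix (m + 1) l μ), ← hU, Matrix.mul_assoc,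
      Matrix.mul_assoc, ← Matrix.mul_assoc (D u w), ← h.D_eq, hV, Matrix.mul_one]
  have hlast := congrFun h1 (Fin.last m)
  have h2 : (lahMatrix (m + 1) l μ).mulVec
      ((D v z)⁻¹.mulVec (iteratedDeriv (m + 1 + 2) v z)) (Fin.last m)
      = l ^ (m + 1) * invZero v z := by
    rw [AffineCurves.invZero_eq v z (i := m) (by omega) rfl, Matrix.mulVec, dotProduct,
      Fin.sum_univ_castSucc, Finset.sum_eq_zero]
    · simp [lahMatrix, lah_self, Fin.last]
    · intro i _
      simp [lahMatrix, lah_eq_zero_of_lt (show (i : ℕ) + 1 < m + 1 by omega)]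
  have hcol : ∀ i (hi : i < m + 1), (D u w)⁻¹.mulVec (iteratedDeriv (i + 1) u w)
      = Pi.single ⟨i, hi⟩ 1 := by
    intro i hi
    have : iteratedDeriv (i + 1) u w = (D u w).mulVec (Pi.single ⟨i, hi⟩ 1) := by
      rw [Matrix.mulVec_single_one]
      rfl
    rw [this, Matrix.mulVec_mulVec, hU, Matrix.one_mulVec]
  have h3 : (D u w)⁻¹.mulVec (iteratedDeriv (m + 1 + 2) v z) (Fin.last m)
      = lah (m + 1 + 2) (m + 1) * l ^ (m + 1) * μ ^ 2
        + lah (m + 1 + 2) (m + 1 + 1) * l ^ (m + 1 + 1) * μ * inv u (m + 1) w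
        + l ^ (m + 1 + 2) * invZero u w := by
    rw [h (m + 1 + 1) le_rfl, Matrix.mulVec_sum, Finset.sum_apply, Finset.sum_range_succ,
      Finset.sum_range_succ, Finset.sum_range_succ, Finset.sum_eq_zero]
    · rw [Matrix.mulVec_smul, Matrix.mulVec_smul, Matrix.mulVec_smul, hcol m (by omega),
        AffineCurves.invZero_eq u w (i := m) (by omega) rfl, inv_succ_eq u w (i := m) (by omega)]
      simp [Fin.last, lah_self, show m + 1 + 1 - m = 2 by omega]
    · intro i hi
      rw [Finset.mem_range] at hi
      rw [Matrix.mulVec_smul, hcol i (by omega)]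
      simp [Fin.last, hi.ne]
  rw [h2, h3] at hlast
  apply mul_left_cancel₀ (pow_ne_zero (m + 1) hl)
  rw [hlast, lah_succ_self]
  push_cast
  ring

/-- The factor `(n + 2) / (2 n)` is the one for which the terms in `l μ I_n` and in `μ²` both
cancel. -/
theorem numerator_eq (h : LahRelated u v w z l μ) (hl : l ≠ 0) (hu : Delta u w ≠ 0) (hn : n ≠ 0) :
    invZero v z - ((n : ℂ) + 2) / (2 * n) * inv v n z ^ 2
      = l ^ 2 * (invZero u w - ((n : ℂ) + 2) / (2 * n) * inv u n w ^ 2) := by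
  have h1 := h.inv_self hl hu hn
  have h2 := h.invZero_eq hl hu hn
  have h3 : (2 * lah (n + 2) n : ℂ) = n * (n + 1) ^ 2 * (n + 2) := by
    exact_mod_cast two_mul_lah_add_two n
  have hn' : (n : ℂ) ≠ 0 := by exact_mod_cast hn
  have h4 : inv v n z = l * inv u n w + n * (n + 1) * μ := by linear_combination h1
  rw [h2, h4]
  field_simp
  linear_combination (n : ℂ) * μ ^ 2 * h3

/-- Numerator and denominator scale by the same power of `l`. With division by zero equal to `0`,
this covers a vanishing denominator too. -/
theorem F_eq (h : LahRelated u v w z l μ) (hl : l ≠ 0) (hu : Delta u w ≠ 0)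
    {j : ℕ} (hj : j ∈ Finset.Icc 1 (n - 1)) : F v j z = F u j w := by
  rw [Finset.mem_Icc] at hj
  have hden := h.den_eq hl hu (by omega)
  by_cases h1 : j = 1
  · simp only [F, if_pos h1]
    rw [h.numerator_eq hl hu (by omega), hden, mul_div_mul_left _ _ (pow_ne_zero 2 hl)]
  · simp only [F, if_neg h1]
    rw [h.weightSum_eq hl hu (by omega) (by omega), hden, mul_pow, mul_pow, ← pow_mul, ← pow_mul,
      Nat.mul_div_cancel' (Nat.dvd_lcm_right 2 (j + 1)),
      Nat.mul_div_cancel' (Nat.dvd_lcm_left 2 (j + 1)), mul_div_mul_left _ _ (pow_ne_zero _ hl)]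

end LahRelated

/-! ### Higher derivatives of a composition with a Möbius transformation. -/

theorem analyticAt_iteratedDeriv {E : Type*} [NormedAddCommGroup E] [NormedSpace ℂ E]
    [CompleteSpace E] {u : ℂ → E} {z : ℂ} (hu : AnalyticAt ℂ u z) (k : ℕ) :
    AnalyticAt ℂ (iteratedDeriv k u) z := by
  rw [iteratedDeriv_eq_iterate]
  exact hu.iterated_deriv k

namespace Moebius

/-- The derivative of `φ`. -/
def deriv₁ (φ : Moebius) (z : ℂ) : ℂ := (φ.a * φ.d - φ.b * φ.c) / (φ.c * z + φ.d) ^ 2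

/-- Half of the logarithmic derivative of `φ'`. -/
def halfLogDeriv (φ : Moebius) (z : ℂ) : ℂ := -φ.c / (φ.c * z + φ.d)

variable (φ : Moebius) {z : ℂ}

theorem isOpen_domain : IsOpen φ.domain :=
  isOpen_ne_fun (by fun_prop) continuous_const

theorem deriv₁_ne_zero (hz : z ∈ φ.domain) : φ.deriv₁ z ≠ 0 :=
  div_ne_zero φ.det_ne_zero (pow_ne_zero 2 hz)

theorem hasDerivAt_denom (z : ℂ) : HasDerivAt (fun z => φ.c * z + φ.d) φ.c z := by
  simpa using ((hasDerivAt_id z).const_mul φ.c).add_const φ.d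

theorem hasDerivAt_toFun (hz : z ∈ φ.domain) : HasDerivAt φ.toFun (φ.deriv₁ z) z := by
  have h1 : HasDerivAt (fun z => φ.a * z + φ.b) φ.a z := by
    simpa using ((hasDerivAt_id z).const_mul φ.a).add_const φ.b
  have hz' : φ.c * z + φ.d ≠ 0 := hz
  refine HasDerivAt.congr_deriv (f := φ.toFun) (h1.div (φ.hasDerivAt_denom z) hz) ?_
  rw [deriv₁]
  ring

theorem hasDerivAt_deriv₁ (hz : z ∈ φ.domain) :
    HasDerivAt φ.deriv₁ (2 * φ.deriv₁ z * φ.halfLogDeriv z) z := by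
  have hz' : φ.c * z + φ.d ≠ 0 := hz
  refine HasDerivAt.congr_deriv (f := φ.deriv₁) (((φ.hasDerivAt_denom z).pow 2).inv
    (pow_ne_zero 2 hz) |>.const_mul (φ.a * φ.d - φ.b * φ.c)) ?_
  rw [deriv₁, halfLogDeriv]
  simp only [Pi.pow_apply, Nat.cast_ofNat, Nat.add_one_sub_one, pow_one]
  field_simp

theorem hasDerivAt_halfLogDeriv (hz : z ∈ φ.domain) :
    HasDerivAt φ.halfLogDeriv (φ.halfLogDeriv z ^ 2) z := by
  have hz' : φ.c * z + φ.d ≠ 0 := hz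
  refine HasDerivAt.congr_deriv (f := φ.halfLogDeriv)
    (((φ.hasDerivAt_denom z).inv hz).const_mul (-φ.c)) ?_
  rw [halfLogDeriv]
  field_simp

theorem analyticAt_toFun (hz : z ∈ φ.domain) : AnalyticAt ℂ φ.toFun z := by
  have hz' : φ.c * z + φ.d ≠ 0 := hz
  unfold toFun
  fun_prop (disch := assumption)

theorem eventually_mem_domain (hz : z ∈ φ.domain) : ∀ᶠ x in 𝓝 z, x ∈ φ.domain :=
  φ.isOpen_domain.mem_nhds hz

/-- The equations `l' = 2 l μ` and `μ' = μ²` form a closed system, so monomials in `l` and `μ`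
differentiate to monomials; the factor is `2 m + (k - m)`. -/
theorem hasDerivAt_coeff (hz : z ∈ φ.domain) {k m : ℕ} (hm : m ≤ k) :
    HasDerivAt (fun z => φ.deriv₁ z ^ m * φ.halfLogDeriv z ^ (k - m))
      ((k + m) * φ.deriv₁ z ^ m * φ.halfLogDeriv z ^ (k + 1 - m)) z := by
  refine HasDerivAt.congr_deriv
    (((φ.hasDerivAt_deriv₁ hz).pow m).mul ((φ.hasDerivAt_halfLogDeriv hz).pow (k - m))) ?_
  have h1 : ∀ (x : ℂ) (j : ℕ), (j : ℂ) * x ^ (j - 1) * x = j * x ^ j := by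
    intro x j
    cases j with
    | zero => simp
    | succ j => rw [Nat.add_sub_cancel, pow_succ, mul_assoc]
  obtain ⟨d, rfl⟩ := Nat.exists_eq_add_of_le hm
  simp only [Pi.pow_apply, Nat.add_sub_cancel_left, show m + d + 1 - m = d + 1 by omega]
  have e1 := h1 (φ.deriv₁ z) m
  have e2 := h1 (φ.halfLogDeriv z) d
  push_cast
  linear_combination (2 * φ.halfLogDeriv z * φ.halfLogDeriv z ^ d) * e1
    + (φ.deriv₁ z ^ m * φ.halfLogDeriv z) * e2

/-- The two terms of the Lah recurrence come from differentiating the coefficient and from the chain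
rule. The identity is kept on a neighbourhood so that it can be differentiated again. -/
theorem iteratedDeriv_comp (u : ℂ → Fin n → ℂ) (hz : z ∈ φ.domain)
    (hu : AnalyticAt ℂ u (φ.toFun z)) (k : ℕ) :
    ∀ᶠ x in 𝓝 z, iteratedDeriv k (fun x => u (φ.toFun x)) x
      = ∑ m ∈ Finset.range (k + 1),
        ((lah k m : ℂ) * (φ.deriv₁ x ^ m * φ.halfLogDeriv x ^ (k - m))) •
          iteratedDeriv m u (φ.toFun x) := by
  induction k with
  | zero => simp [lah]
  | succ k ih =>
    have hana : ∀ᶠ x in 𝓝 z, AnalyticAt ℂ u (φ.toFun x) :=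
      (φ.hasDerivAt_toFun hz).continuousAt.eventually hu.eventually_analyticAt
    filter_upwards [ih.eventually_nhds, φ.eventually_mem_domain hz, hana] with x hx hxd hxu
    rw [iteratedDeriv_succ, EventuallyEq.deriv_eq hx]
    have hU : ∀ m, HasDerivAt (fun x => iteratedDeriv m u (φ.toFun x))
        (φ.deriv₁ x • iteratedDeriv (m + 1) u (φ.toFun x)) x := by
      intro m
      have h1 : HasDerivAt (iteratedDeriv m u) (iteratedDeriv (m + 1) u (φ.toFun x))
          (φ.toFun x) := by
        rw [iteratedDeriv_succ]
        exact (analyticAt_iteratedDeriv hxu m).differentiableAt.hasDerivAt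
      exact h1.scomp x (φ.hasDerivAt_toFun hxd)
    have hsum : HasDerivAt (fun x => ∑ m ∈ Finset.range (k + 1),
        ((lah k m : ℂ) * (φ.deriv₁ x ^ m * φ.halfLogDeriv x ^ (k - m))) •
          iteratedDeriv m u (φ.toFun x))
        (∑ m ∈ Finset.range (k + 1),
          (((lah k m : ℂ) * (φ.deriv₁ x ^ m * φ.halfLogDeriv x ^ (k - m))) •
            φ.deriv₁ x • iteratedDeriv (m + 1) u (φ.toFun x) +
          ((lah k m : ℂ) * ((k + m) * φ.deriv₁ x ^ m * φ.halfLogDeriv x ^ (k + 1 - m))) •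
            iteratedDeriv m u (φ.toFun x))) x := by
      refine HasDerivAt.fun_sum fun m hm => ?_
      exact ((φ.hasDerivAt_coeff hxd (by simpa [Nat.lt_succ_iff] using hm)).const_mul
        (lah k m : ℂ)).smul (hU m)
    rw [hsum.deriv, Finset.sum_add_distrib, Finset.sum_range_succ' _ (k + 1), lah_succ_zero]
    simp only [lah_succ_succ, Nat.cast_zero, zero_mul, zero_smul, add_zero]
    -- Index shift: the term lost at `m = 0` vanishes because `k * lah k 0 = 0`, the one gained at
    -- the top because `lah k (k + 1) = 0`.
    have h2 : ∑ m ∈ Finset.range (k + 1), ((lah k m : ℂ) *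
        ((k + m) * φ.deriv₁ x ^ m * φ.halfLogDeriv x ^ (k + 1 - m))) •
          iteratedDeriv m u (φ.toFun x)
        = ∑ m ∈ Finset.range (k + 1), ((lah k (m + 1) : ℂ) *
        ((k + (m + 1 : ℕ)) * φ.deriv₁ x ^ (m + 1) * φ.halfLogDeriv x ^ (k + 1 - (m + 1)))) •
          iteratedDeriv (m + 1) u (φ.toFun x) := by
      have h3 := Finset.sum_range_succ (fun m => ((lah k m : ℂ) *
        ((k + m) * φ.deriv₁ x ^ m * φ.halfLogDeriv x ^ (k + 1 - m))) •
          iteratedDeriv m u (φ.toFun x)) (k + 1)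
      have h4 : ((lah k 0 : ℂ) * (k + (0 : ℕ))) = 0 := by
        cases k with
        | zero => simp
        | succ k => simp [lah]
      rw [lah_eq_zero_of_lt (Nat.lt_succ_self k), Finset.sum_range_succ',
        ← mul_assoc, ← mul_assoc, h4] at h3
      simpa using h3.symm
    rw [h2, ← Finset.sum_add_distrib]
    refine Finset.sum_congr rfl fun m _ => ?_
    rw [smul_smul, ← add_smul, Nat.add_sub_add_right]
    congr 1
    push_cast
    ring

theorem lahRelated_comp (u : ℂ → Fin n → ℂ) (hz : z ∈ φ.domain)
    (hu : AnalyticAt ℂ u (φ.toFun z)) :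
    LahRelated u (fun x => u (φ.toFun x)) (φ.toFun z) z (φ.deriv₁ z) (φ.halfLogDeriv z) := by
  intro k hk
  rw [(φ.iteratedDeriv_comp u hz hu (k + 1)).self_of_nhds, Finset.sum_range_succ', lah_succ_zero]
  simp only [Nat.cast_zero, zero_mul, zero_smul, add_zero, Nat.add_sub_add_right, ← mul_assoc]
  apply Finset.sum_subset
  · intro i hi
    simp only [Finset.mem_range] at hi ⊢
    omega
  · intro i _ hi
    simp only [Finset.mem_range, not_lt] at hi
    rw [lah_eq_zero_of_lt (by omega)]
    simp

end Moebius

/-! ### Affine invariance. -/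

section Affine

variable {A : Matrix (Fin n) (Fin n) ℂ} {b : Fin n → ℂ} {u v : ℂ → Fin n → ℂ} {z : ℂ}

theorem iteratedDeriv_affine (hu : AnalyticAt ℂ u z)
    (h : ∀ᶠ x in 𝓝 z, v x = A.mulVec (u x) + b) (k : ℕ) :
    iteratedDeriv (k + 1) v z = A.mulVec (iteratedDeriv (k + 1) u z) := by
  have key : ∀ k, ∀ᶠ x in 𝓝 z, iteratedDeriv (k + 1) v x = A.mulVec (iteratedDeriv (k + 1) u x) := by
    have hd : ∀ {f : ℂ → Fin n → ℂ} {x : ℂ}, DifferentiableAt ℂ f x → ∀ c : Fin n → ℂ,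
        HasDerivAt (fun y => A.mulVec (f y) + c) (A.mulVec (deriv f x)) x := by
      intro f x hf c
      exact ((LinearMap.toContinuousLinearMap A.mulVecLin).hasFDerivAt.comp_hasDerivAt x
        hf.hasDerivAt).add_const c
    intro k
    induction k with
    | zero =>
      filter_upwards [h.eventually_nhds, hu.eventually_analyticAt] with x hx hxu
      rw [zero_add, iteratedDeriv_one, iteratedDeriv_one, EventuallyEq.deriv_eq hx]
      exact (hd hxu.differentiableAt b).deriv
    | succ k ih =>
      filter_upwards [ih.eventually_nhds, hu.eventually_analyticAt] with x hx hxu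
      rw [iteratedDeriv_succ, EventuallyEq.deriv_eq hx, iteratedDeriv_succ (n := k + 1)]
      simpa using (hd (analyticAt_iteratedDeriv hxu (k + 1)).differentiableAt 0).deriv
  exact (key k).self_of_nhds

theorem derivMatrix_affine (h : ∀ k, iteratedDeriv (k + 1) v z = A.mulVec (iteratedDeriv (k + 1) u z))
    {e : Fin n → ℕ} (he : ∀ j, e j ≠ 0) : derivMatrix v e z = A * derivMatrix u e z := by
  ext r j
  obtain ⟨k, hk⟩ := Nat.exists_eq_succ_of_ne_zero (he j)
  have := congrFun (h k) r
  simp only [derivMatrix, Matrix.of_apply, Matrix.mul_apply, hk]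
  exact this

theorem D_affine (h : ∀ k, iteratedDeriv (k + 1) v z = A.mulVec (iteratedDeriv (k + 1) u z)) :
    D v z = A * D u z :=
  derivMatrix_affine h fun _ => Nat.succ_ne_zero _

theorem inv_affine (h : ∀ k, iteratedDeriv (k + 1) v z = A.mulVec (iteratedDeriv (k + 1) u z))
    (hA : A.det ≠ 0) (i : ℕ) : inv v i z = inv u i z := by
  rw [inv, inv, detA, detA, Delta, Delta, D_affine h, derivMatrix_affine h, Matrix.det_mul,
    Matrix.det_mul, mul_div_mul_left _ _ hA]
  intro j
  split_ifs <;> omega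

theorem invZero_affine (h : ∀ k, iteratedDeriv (k + 1) v z = A.mulVec (iteratedDeriv (k + 1) u z))
    (hA : A.det ≠ 0) : invZero v z = invZero u z := by
  rw [invZero, invZero, Delta, Delta, D_affine h, derivMatrix_affine h, Matrix.det_mul,
    Matrix.det_mul, mul_div_mul_left _ _ hA]
  intro j
  split_ifs <;> omega

theorem den_affine (h : ∀ k, iteratedDeriv (k + 1) v z = A.mulVec (iteratedDeriv (k + 1) u z))
    (hA : A.det ≠ 0) : den v z = den u z := by
  simp only [den, inv_affine h hA]

theorem F_affine (h : ∀ k, iteratedDeriv (k + 1) v z = A.mulVec (iteratedDeriv (k + 1) u z))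
    (hA : A.det ≠ 0) (j : ℕ) : F v j z = F u j z := by
  simp only [F, weightSum, den_affine h hA, inv_affine h hA, invZero_affine h hA]

end Affine

/-! ### Vanishing Wronskians and linear dependence. -/

theorem iteratedDeriv_clm_comp {E G : Type*} [NormedAddCommGroup E] [NormedSpace ℂ E]
    [CompleteSpace E] [NormedAddCommGroup G] [NormedSpace ℂ G]
    {w : ℂ → E} {z : ℂ} (hw : AnalyticAt ℂ w z) (L : E →L[ℂ] G) (k : ℕ) :
    iteratedDeriv k (fun x => L (w x)) z = L (iteratedDeriv k w z) := by
  have h := L.iteratedFDeriv_comp_left (f := w) (x := z) (n := ⊤) (i := k) hw.contDiffAt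
    (by exact_mod_cast le_top)
  rw [iteratedDeriv_eq_iteratedFDeriv, iteratedDeriv_eq_iteratedFDeriv]
  change iteratedFDeriv ℂ k (⇑L ∘ w) z _ = _
  rw [h]
  rfl

theorem iteratedDeriv_add_apply {E : Type*} [NormedAddCommGroup E] [NormedSpace ℂ E]
    (f : ℂ → E) (m k : ℕ) : iteratedDeriv (m + k) f = iteratedDeriv m (iteratedDeriv k f) := by
  simp only [iteratedDeriv_eq_iterate, Function.iterate_add_apply]

/-- Uniqueness for linear differential equations with analytic coefficients. -/
theorem eventually_eq_zero_of_linear_ode {g : ℂ → ℂ} {z : ℂ} (hg : AnalyticAt ℂ g z) {k : ℕ}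
    {c : Fin k → ℂ → ℂ} (hc : ∀ j, AnalyticAt ℂ (c j) z)
    (hode : ∀ᶠ x in 𝓝 z, iteratedDeriv k g x = ∑ j, c j x * iteratedDeriv j g x)
    (h0 : ∀ j < k, iteratedDeriv j g z = 0) : ∀ᶠ x in 𝓝 z, g x = 0 := by
  -- Differentiating the equation by Leibniz' rule expresses each derivative of order at least `k`
  -- at `z` through lower ones, so the whole Taylor series vanishes.
  have hall : ∀ m, iteratedDeriv m g z = 0 := by
    intro m
    induction m using Nat.strong_induction_on with
    | _ m ih =>
      rcases lt_or_ge m k with hm | hm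
      · exact h0 m hm
      · obtain ⟨d, rfl⟩ := Nat.exists_eq_add_of_le' hm
        have hga : ∀ j : Fin k, AnalyticAt ℂ (iteratedDeriv j g) z :=
          fun j => analyticAt_iteratedDeriv hg j
        rw [iteratedDeriv_add_apply, EventuallyEq.iteratedDeriv_eq d hode,
          iteratedDeriv_fun_sum fun j _ => ((hc j).fun_mul (hga j)).contDiffAt]
        refine Finset.sum_eq_zero fun j _ => ?_
        rw [iteratedDeriv_fun_mul (hc j).contDiffAt (hga j).contDiffAt]
        refine Finset.sum_eq_zero fun i _ => ?_
        rw [← iteratedDeriv_add_apply, ih _ (by omega), mul_zero]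
  rw [← analyticOrderAt_eq_top]
  refine ENat.eq_top_iff_forall_ge.2 fun m => ?_
  exact (natCast_le_analyticOrderAt_iff_iteratedDeriv_eq_zero hg).2 fun i _ => hall i

theorem analyticAt_det {k : ℕ} {C : ℂ → Matrix (Fin k) (Fin k) ℂ} {z : ℂ}
    (hC : ∀ i j, AnalyticAt ℂ (fun x => C x i j) z) : AnalyticAt ℂ (fun x => (C x).det) z := by
  simp only [Matrix.det_apply']
  refine Finset.analyticAt_fun_sum _ fun σ _ => ?_
  exact analyticAt_const.fun_mul (Finset.analyticAt_fun_prod _ fun i _ => hC _ _)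

/-- If the Wronskian of the components of `w` vanishes on an open set, these components are linearly
dependent near some point of the set. -/
theorem exists_dotProduct_eq_zero_of_wronskian {w : ℂ → Fin n → ℂ} {U : Set ℂ} (hU : IsOpen U)
    (hne : U.Nonempty) (hw : ∀ z ∈ U, AnalyticAt ℂ w z)
    (hdet : ∀ z ∈ U, (Matrix.of fun r j : Fin n => iteratedDeriv j w z r).det = 0) :
    ∃ a : Fin n → ℂ, a ≠ 0 ∧ ∃ z ∈ U, ∀ᶠ x in 𝓝 z, ∑ i, a i * w x i = 0 := by
  -- For `k` with `P k` but not `P (k + 1)`, near `z₁` the `k`-th derivative depends linearly on the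
  -- lower ones, which are independent.
  let P : ℕ → Prop := fun k => ∃ z ∈ U, LinearIndependent ℂ (fun j : Fin k => iteratedDeriv j w z)
  have hP0 : P 0 := by
    obtain ⟨z, hz⟩ := hne
    exact ⟨z, hz, linearIndependent_empty_type⟩
  have hPn : ¬ P n := by
    rintro ⟨z, hz, hli⟩
    have := Matrix.linearIndependent_cols_iff_isUnit
      (A := Matrix.of fun r j : Fin n => iteratedDeriv j w z r) |>.1 hli
    rw [Matrix.isUnit_iff_isUnit_det, hdet z hz] at this
    exact not_isUnit_zero this
  obtain ⟨k, hkn, ⟨z₁, hz₁, hli⟩, hk1⟩ : ∃ k < n, P k ∧ ¬ P (k + 1) := by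
    by_contra! hcon
    have : ∀ k ≤ n, P k := by
      intro k
      induction k with
      | zero => exact fun _ => hP0
      | succ k ih => exact fun h => hcon k (by omega) (ih (by omega))
    exact hPn (this n le_rfl)
  -- Projecting by `g` makes the first `k` derivatives a square matrix `C`, equal to `1` at `z₁`.
  -- Cramer's rule for `C` then gives analytic coefficients `c j`.
  obtain ⟨g, hg⟩ : ∃ g : (Fin n → ℂ) →ₗ[ℂ] (Fin k → ℂ),
      ∀ j : Fin k, g (iteratedDeriv j w z₁) = Pi.single j 1 := by
    obtain ⟨g, hg⟩ := LinearMap.exists_leftInverse_of_injective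
      (Fintype.linearCombination ℂ (fun j : Fin k => iteratedDeriv j w z₁))
      (LinearMap.ker_eq_bot.2 (linearIndependent_iff_injective_fintypeLinearCombination.1 hli))
    refine ⟨g, fun j => ?_⟩
    have := LinearMap.congr_fun hg (Pi.single j 1)
    simpa [Fintype.linearCombination_apply_single] using this
  let G : (Fin n → ℂ) →L[ℂ] (Fin k → ℂ) := LinearMap.toContinuousLinearMap g
  have hG : ∀ x, G x = g x := fun _ => rfl
  let C : ℂ → Matrix (Fin k) (Fin k) ℂ := fun z => Matrix.of fun i j => G (iteratedDeriv j w z) i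
  have hGana : ∀ (m : ℕ) i, AnalyticAt ℂ (fun x => G (iteratedDeriv m w x) i) z₁ := by
    intro m i
    have h1 : AnalyticAt ℂ (fun x => G (iteratedDeriv m w x)) z₁ :=
      (G.analyticAt _).comp (analyticAt_iteratedDeriv (hw z₁ hz₁) m)
    exact (ContinuousLinearMap.proj (R := ℂ) (φ := fun _ : Fin k => ℂ) i).analyticAt _ |>.comp h1
  have hC1 : (C z₁).det ≠ 0 := by
    have : C z₁ = 1 := by
      ext i j
      simp only [C, Matrix.of_apply, hG, hg, Matrix.one_apply, Pi.single_apply]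
    rw [this, Matrix.det_one]
    exact one_ne_zero
  have hCana : AnalyticAt ℂ (fun x => (C x).det) z₁ := analyticAt_det fun i j => hGana j i
  let c : Fin k → ℂ → ℂ := fun j x => ((C x)⁻¹.mulVec (G (iteratedDeriv k w x))) j
  have hc : ∀ j, AnalyticAt ℂ (c j) z₁ := by
    intro j
    simp only [c, inv_mulVec_eq_cramer_div]
    refine AnalyticAt.fun_div (analyticAt_det fun i l => ?_) hCana hC1
    simp only [Matrix.updateCol_apply]
    split_ifs
    · exact hGana k i
    · exact hGana l i
  have hrel : ∀ᶠ x in 𝓝 z₁, iteratedDeriv k w x = ∑ j : Fin k, c j x • iteratedDeriv j w x := by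
    filter_upwards [hU.mem_nhds hz₁, hCana.continuousAt.eventually_ne hC1] with x hx hdx
    have hli' : LinearIndependent ℂ (fun j : Fin k => iteratedDeriv j w x) := by
      refine LinearIndependent.of_comp g ?_
      exact Matrix.linearIndependent_cols_iff_isUnit (A := C x) |>.2
        ((Matrix.isUnit_iff_isUnit_det _).2 (isUnit_iff_ne_zero.2 hdx))
    have hmem : iteratedDeriv k w x ∈ Submodule.span ℂ
        (Set.range fun j : Fin k => iteratedDeriv j w x) := by
      by_contra hnot
      refine hk1 ⟨x, hx, ?_⟩
      have := linearIndependent_finSnoc.2 ⟨hli', hnot⟩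
      have hsnoc : (Fin.snoc (fun j : Fin k => iteratedDeriv j w x) (iteratedDeriv k w x) :
          Fin (k + 1) → Fin n → ℂ) = fun j : Fin (k + 1) => iteratedDeriv j w x := by
        ext j : 1
        refine Fin.lastCases ?_ (fun i => ?_) j <;> simp
      rwa [hsnoc] at this
    obtain ⟨d, hd⟩ := (Submodule.mem_span_range_iff_exists_fun ℂ).1 hmem
    have hCd : (C x).mulVec d = G (iteratedDeriv k w x) := by
      rw [← hd, map_sum]
      ext i
      simp [Matrix.mulVec, dotProduct, C, Finset.sum_apply, mul_comm]
    have : ∀ j, c j x = d j := by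
      intro j
      simp only [c, ← hCd]
      rw [Matrix.mulVec_mulVec, Matrix.nonsing_inv_mul _ (isUnit_iff_ne_zero.2 hdx),
        Matrix.one_mulVec]
    simp only [this, hd]
  -- Since `k < n`, some nonzero `a` kills the first `k` derivatives at `z₁`. Then `a · w` solves a
  -- linear equation of order `k` with zero initial data.
  obtain ⟨a, ha, ha0⟩ : ∃ a : Fin n → ℂ,
      (∀ j : Fin k, ∑ i, a i * iteratedDeriv j w z₁ i = 0) ∧ a ≠ 0 := by
    let M : Matrix (Fin k) (Fin n) ℂ := Matrix.of fun j i => iteratedDeriv j w z₁ i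
    have hker : LinearMap.ker M.mulVecLin ≠ ⊥ :=
      LinearMap.ker_ne_bot_of_finrank_lt (by simpa using hkn)
    obtain ⟨a, ha, ha0⟩ := (Submodule.ne_bot_iff _).1 hker
    refine ⟨a, fun j => ?_, ha0⟩
    have := congrFun (LinearMap.mem_ker.1 ha) j
    simpa [Matrix.mulVec, dotProduct, M, mul_comm] using this
  let ℓ : (Fin n → ℂ) →L[ℂ] ℂ :=
    ∑ i, a i • ContinuousLinearMap.proj (R := ℂ) (φ := fun _ : Fin n => ℂ) i
  have hℓ : ∀ x, ℓ x = ∑ i, a i * x i := by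
    intro x
    simp [ℓ]
  refine ⟨a, ha0, z₁, hz₁, ?_⟩
  simp only [← hℓ]
  have hd : ∀ x ∈ U, ∀ m, iteratedDeriv m (fun x => ℓ (w x)) x = ℓ (iteratedDeriv m w x) :=
    fun x hx m => iteratedDeriv_clm_comp (hw x hx) ℓ m
  have hℓw : AnalyticAt ℂ (fun x => ℓ (w x)) z₁ := (ℓ.analyticAt _).comp (hw z₁ hz₁)
  refine eventually_eq_zero_of_linear_ode hℓw hc ?_ ?_
  · filter_upwards [hrel, hU.mem_nhds hz₁] with x hx hxU
    simp only [hd x hxU]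
    rw [hx, map_sum]
    simp
  · intro j hj
    rw [hd z₁ hz₁, hℓ]
    exact ha ⟨j, hj⟩

/-! ### Codiscrete and cocountable sets. -/

theorem eventually_codiscreteWithin_iff {U : Set ℂ} (hU : IsOpen U) {P : ℂ → Prop} :
    (∀ᶠ x in codiscreteWithin U, P x) ↔ ∀ z ∈ U, ∀ᶠ x in 𝓝[≠] z, P x := by
  rw [Filter.Eventually, mem_codiscreteWithin_iff_forall_mem_nhdsNE]
  refine forall₂_congr fun z hz => ?_
  have hUz : U ∈ 𝓝[≠] z := nhdsWithin_le_nhds (hU.mem_nhds hz)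
  constructor
  · intro h
    filter_upwards [h, hUz] with x hx hxU
    exact hx.resolve_right fun h => h hxU
  · intro h
    filter_upwards [h] with x hx
    exact Or.inl hx

theorem eventually_codiscrete_iff {P : ℂ → Prop} :
    (∀ᶠ x in codiscrete ℂ, P x) ↔ ∀ z, ∀ᶠ x in 𝓝[≠] z, P x := by
  rw [codiscrete, eventually_codiscreteWithin_iff isOpen_univ]
  simp

theorem countable_setOf_not {P : ℂ → Prop} (h : ∀ᶠ x in codiscrete ℂ, P x) :
    {x | ¬ P x}.Countable := by
  have h1 : IsDiscrete ({x | ¬ P x} ∩ Set.univ) := by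
    refine isDiscrete_of_codiscreteWithin ?_
    have : {x | ¬ P x}ᶜ = {x | P x} := by ext; simp
    rw [this]
    exact h
  rw [Set.inter_univ] at h1
  exact (HereditarilyLindelofSpace.isLindelof _).countable_of_isDiscrete h1

theorem frequently_notMem_of_countable {N : Set ℂ} (hN : N.Countable) (z : ℂ) :
    ∃ᶠ x in 𝓝[≠] z, x ∉ N := by
  have h1 : Dense (insert z N)ᶜ := (hN.insert z).dense_compl ℂ
  have h2 := mem_closure_iff_frequently.1 (h1 z)
  rw [frequently_nhdsWithin_iff]
  refine h2.mono fun x hx => ?_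
  rw [Set.mem_compl_iff, Set.mem_insert_iff, not_or] at hx
  exact ⟨hx.2, hx.1⟩

theorem exists_notMem_of_eventually {N : Set ℂ} (hN : N.Countable) {z : ℂ} {P : ℂ → Prop}
    (h : ∀ᶠ x in 𝓝[≠] z, P x) : ∃ x, x ≠ z ∧ x ∉ N ∧ P x := by
  obtain ⟨x, hx⟩ := ((frequently_notMem_of_countable hN z).and_eventually
    (h.and eventually_mem_nhdsWithin)).exists
  exact ⟨x, hx.2.2, hx.1, hx.2.1⟩

/-! ### Meromorphic functions injective off a countable set are Möbius. -/

/-- Liouville's theorem for meromorphic functions that are bounded off a countable set. -/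
theorem exists_const_of_meromorphic_of_bounded {h : ℂ → ℂ} (hh : Meromorphic h) {N : Set ℂ}
    (hN : N.Countable) {K : ℝ} (hK : ∀ z ∉ N, ‖h z‖ ≤ K) :
    ∃ c, ∀ᶠ z in codiscrete ℂ, h z = c := by
  have hord : ∀ z, 0 ≤ meromorphicOrderAt h z := by
    intro z
    by_contra hneg
    have hinf := tendsto_cobounded_of_meromorphicOrderAt_neg (not_le.1 hneg)
    have hbig : ∀ᶠ x in 𝓝[≠] z, K < ‖h x‖ :=
      (tendsto_norm_cobounded_atTop.comp hinf).eventually_gt_atTop K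
    obtain ⟨x, -, hxN, hx⟩ := exists_notMem_of_eventually hN hbig
    exact absurd (hK x hxN) (not_le.2 hx)
  have hh' : MeromorphicOn h Set.univ := fun z _ => hh z
  set H := toMeromorphicNFOn h Set.univ with hH
  have hana : ∀ z, AnalyticAt ℂ H z := by
    intro z
    have hNF := meromorphicNFOn_toMeromorphicNFOn h Set.univ (Set.mem_univ z)
    rw [← hNF.meromorphicOrderAt_nonneg_iff_analyticAt,
      meromorphicOrderAt_toMeromorphicNFOn hh' (Set.mem_univ z)]
    exact hord z
  have hdiff : Differentiable ℂ H := fun z => (hana z).differentiableAt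
  have heq : ∀ᶠ z in codiscrete ℂ, h z = H z := toMeromorphicNFOn_eqOn_codiscrete hh'
  have hbd : ∀ z, ‖H z‖ ≤ K := by
    intro z
    have hcl : IsClosed {z | ‖H z‖ ≤ K} :=
      isClosed_le hdiff.continuous.norm continuous_const
    have hsub : (N ∪ {z | ¬ h z = H z})ᶜ ⊆ {z | ‖H z‖ ≤ K} := by
      intro x hx
      simp only [Set.mem_compl_iff, Set.mem_union, Set.mem_ofPred_eq, not_or, not_not] at hx
      simpa [← hx.2] using hK x hx.1
    exact hcl.closure_subset_iff.2 hsub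
      ((hN.union (countable_setOf_not heq)).dense_compl ℂ z)
  have hrange : Bornology.IsBounded (Set.range H) := by
    rw [isBounded_iff_forall_norm_le]
    exact ⟨K, by rintro _ ⟨z, rfl⟩; exact hbd z⟩
  refine ⟨H 0, heq.mono fun z hz => ?_⟩
  rw [hz]
  exact hdiff.apply_eq_apply_of_bounded hrange z 0

theorem not_eventually_const_of_injOn {ψ : ℂ → ℂ} {N : Set ℂ} (hN : N.Countable)
    (hinj : Set.InjOn ψ Nᶜ) (z c : ℂ) : ¬ ∀ᶠ x in 𝓝[≠] z, ψ x = c := by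
  intro h
  obtain ⟨x, hxz, hxN, hx⟩ := exists_notMem_of_eventually hN h
  obtain ⟨y, hyz, hyN, hy⟩ := exists_notMem_of_eventually (hN.insert x) h
  rw [Set.mem_insert_iff, not_or] at hyN
  exact hyN.1 (hinj hyN.2 hxN (hy.trans hx.symm))

theorem exists_deriv_ne_zero_of_injOn {ψ : ℂ → ℂ} (hψ : Meromorphic ψ) {N : Set ℂ}
    (hN : N.Countable) (hinj : Set.InjOn ψ Nᶜ) :
    ∃ z, z ∉ N ∧ AnalyticAt ℂ ψ z ∧ deriv ψ z ≠ 0 := by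
  obtain ⟨z, -, -, hz⟩ := exists_notMem_of_eventually hN (hψ 0).eventually_analyticAt
  rcases hz.deriv.eventually_eq_zero_or_eventually_ne_zero with h | h
  · exfalso
    obtain ⟨ε, hε, hball⟩ := Metric.eventually_nhds_iff_ball.1 (h.and hz.eventually_analyticAt)
    refine not_eventually_const_of_injOn hN hinj z (ψ z) (nhdsWithin_le_nhds ?_)
    filter_upwards [Metric.ball_mem_nhds z hε] with x hx
    exact Metric.isOpen_ball.is_const_of_deriv_eq_zero (convex_ball z ε).isPreconnected
      (fun y hy => (hball y hy).2.differentiableAt.differentiableWithinAt)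
      (fun y hy => (hball y hy).1) hx (Metric.mem_ball_self hε)
  · obtain ⟨x, -, hxN, hx⟩ := exists_notMem_of_eventually hN
      (h.and (nhdsWithin_le_nhds hz.eventually_analyticAt))
    exact ⟨x, hxN, hx.2, hx.1⟩

/-- The principal part of `1 / (ψ - ψ z₀)` at a simple zero of the denominator. -/
theorem tendsto_inv_sub_sub_inv {ψ : ℂ → ℂ} {z₀ : ℂ} (hψ : AnalyticAt ℂ ψ z₀)
    (hd : deriv ψ z₀ ≠ 0) :
    ∃ c, Tendsto (fun z => (ψ z - ψ z₀)⁻¹ - (deriv ψ z₀)⁻¹ * (z - z₀)⁻¹) (𝓝[≠] z₀) (𝓝 c) := by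
  obtain ⟨p, hp⟩ := hψ
  -- With `k = dslope ψ z₀`, the expression is the difference quotient of `1 / k` at `z₀`.
  have hk : AnalyticAt ℂ (dslope ψ z₀) z₀ := hp.has_fpower_series_dslope_fslope.analyticAt
  have hk0 : dslope ψ z₀ z₀ ≠ 0 := by rwa [dslope_same]
  have hm := (hk.inv hk0).differentiableAt.hasDerivAt
  refine ⟨_, (hasDerivAt_iff_tendsto_slope.1 hm).congr' ?_⟩
  filter_upwards [self_mem_nhdsWithin] with z hz
  rw [slope_def_field, Pi.inv_apply, Pi.inv_apply, dslope_same, dslope_of_ne _ hz,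
    slope_def_field, inv_div]
  have : z - z₀ ≠ 0 := sub_ne_zero.2 hz
  rw [sub_div, div_div_cancel_left' this, div_eq_mul_inv]

/-- The function `h` is bounded near `z₀` because its principal part is removed. Away from `z₀` it
is bounded because `ψ` maps a disc about `z₀` onto a neighbourhood of `ψ z₀`, so injectivity keeps
other values at a distance. -/
theorem exists_moebius_of_injOn {ψ : ℂ → ℂ} (hψ : Meromorphic ψ) {N : Set ℂ}
    (hN : N.Countable) (hinj : Set.InjOn ψ Nᶜ) :
    ∃ φ : Moebius, ∃ N' : Set ℂ, N'.Countable ∧ ∀ z ∉ N', z ∈ φ.domain ∧ ψ z = φ.toFun z := by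
  obtain ⟨z₀, hz₀N, hana, hd⟩ := exists_deriv_ne_zero_of_injOn hψ hN hinj
  set α := (deriv ψ z₀)⁻¹ with hα
  have hα0 : α ≠ 0 := inv_ne_zero hd
  set h : ℂ → ℂ := fun z => (ψ z - ψ z₀)⁻¹ - α * (z - z₀)⁻¹ with hh
  have hmer : Meromorphic h := by
    intro z
    have h1 := hψ z
    simp only [hh]
    fun_prop
  obtain ⟨c₁, hc₁⟩ := tendsto_inv_sub_sub_inv hana hd
  have hnear : ∀ᶠ z in 𝓝 z₀, z ≠ z₀ → ‖h z‖ < ‖c₁‖ + 1 :=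
    eventually_nhdsWithin_iff.1 (hc₁.norm.eventually_lt_const (lt_add_one _))
  obtain ⟨ε, hε, hball⟩ := Metric.eventually_nhds_iff_ball.1 hnear
  have hopen : 𝓝 (ψ z₀) ≤ map ψ (𝓝 z₀) := by
    refine hana.eventually_constant_or_nhds_le_map_nhds.resolve_left fun hc => ?_
    exact not_eventually_const_of_injOn hN hinj z₀ _ (nhdsWithin_le_nhds hc)
  obtain ⟨r, hr, himg⟩ := Metric.mem_nhds_iff.1
    (hopen (image_mem_map (Metric.ball_mem_nhds z₀ hε)))
  -- The preimage supplied by the open mapping theorem may lie in `N`, where injectivity says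
  -- nothing; `T` collects the points affected.
  set T : Set ℂ := {z | z ∉ N ∧ ψ z ∈ ψ '' N} with hT
  have hTc : T.Countable :=
    Set.MapsTo.countable_of_injOn (t := ψ '' N) (fun z hz => hz.2)
      (hinj.mono fun z hz => hz.1) (hN.image ψ)
  have hfar : ∀ z ∉ N ∪ T, z ∉ Metric.ball z₀ ε → r ≤ ‖ψ z - ψ z₀‖ := by
    intro z hz hzb
    rw [Set.mem_union, not_or] at hz
    by_contra! hlt
    obtain ⟨y, hyb, hy⟩ := himg (by rwa [Metric.mem_ball, dist_eq_norm] : ψ z ∈ _)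
    by_cases hyN : y ∈ N
    · exact hz.2 ⟨hz.1, y, hyN, hy⟩
    · exact hzb (hinj hyN hz.1 hy ▸ hyb)
  obtain ⟨c, hc⟩ := exists_const_of_meromorphic_of_bounded hmer ((hN.union hTc).insert z₀)
    (K := max (‖c₁‖ + 1) (r⁻¹ + ‖α‖ * ε⁻¹)) (by
      intro z hz
      rw [Set.mem_insert_iff, not_or] at hz
      by_cases hzb : z ∈ Metric.ball z₀ ε
      · exact le_max_of_le_left (hball z hzb hz.1).le
      · refine le_max_of_le_right ((norm_sub_le _ _).trans (add_le_add ?_ ?_))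
        · rw [norm_inv]
          exact inv_anti₀ hr (hfar z hz.2 hzb)
        · rw [norm_mul, norm_inv (z - z₀)]
          rw [Metric.mem_ball, dist_eq_norm, not_lt] at hzb
          gcongr)
  -- Solving `1 / (ψ z - ψ z₀) = c + α / (z - z₀)` for `ψ z` gives these coefficients; the
  -- determinant is `α`.
  refine ⟨⟨ψ z₀ * c + 1, ψ z₀ * α - (ψ z₀ * c + 1) * z₀, c, α - c * z₀, ?_⟩,
    insert z₀ (N ∪ {z | ¬ h z = c}), (hN.union (countable_setOf_not hc)).insert z₀, ?_⟩
  · convert hα0 using 1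
    ring
  · intro z hz
    simp only [Set.mem_insert_iff, Set.mem_union, Set.mem_ofPred_eq, not_or, not_not] at hz
    obtain ⟨hzz, hzN, hzc⟩ := hz
    have hy : z - z₀ ≠ 0 := sub_ne_zero.2 hzz
    have hψ' : ψ z - ψ z₀ ≠ 0 := sub_ne_zero.2 fun e => hzz (hinj hzN hz₀N e)
    simp only [hh] at hzc
    have h1 : (ψ z - ψ z₀) * (c * (z - z₀) + α) = z - z₀ := by
      rw [← hzc]
      field_simp
      ring
    have h2 : c * z + (α - c * z₀) ≠ 0 := by
      intro h0
      apply hy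
      rw [← h1, show c * (z - z₀) + α = c * z + (α - c * z₀) by ring, h0, mul_zero]
    refine ⟨h2, ?_⟩
    rw [Moebius.toFun, eq_div_iff h2]
    linear_combination h1

/-! ### Möbius transformations as bijections of the sphere. -/

namespace Moebius

variable (φ : Moebius) {z : ℂ}

/-- The inverse Möbius transformation. -/
def symm : Moebius where
  a := φ.d
  b := -φ.b
  c := -φ.c
  d := φ.a
  det_ne_zero := by
    intro h
    apply φ.det_ne_zero
    linear_combination h

@[simp]
theorem symm_symm : φ.symm.symm = φ := by simp [symm]

theorem toFun_mem_domain_symm (hz : z ∈ φ.domain) : φ.toFun z ∈ φ.symm.domain := by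
  have hz' : φ.c * z + φ.d ≠ 0 := hz
  change -φ.c * ((φ.a * z + φ.b) / (φ.c * z + φ.d)) + φ.a ≠ 0
  intro h
  apply φ.det_ne_zero
  field_simp at h
  linear_combination h

theorem symm_toFun_toFun (hz : z ∈ φ.domain) : φ.symm.toFun (φ.toFun z) = z := by
  have hz' : φ.c * z + φ.d ≠ 0 := hz
  have h1 : -φ.c * ((φ.a * z + φ.b) / (φ.c * z + φ.d)) + φ.a ≠ 0 := φ.toFun_mem_domain_symm hz
  change (φ.d * ((φ.a * z + φ.b) / (φ.c * z + φ.d)) + -φ.b) /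
    (-φ.c * ((φ.a * z + φ.b) / (φ.c * z + φ.d)) + φ.a) = z
  rw [div_eq_iff h1]
  apply mul_right_cancel₀ hz'
  linear_combination (φ.d + φ.c * z) * div_mul_cancel₀ (φ.a * z + φ.b) hz'

theorem toFun_symm_toFun (hz : z ∈ φ.symm.domain) : φ.toFun (φ.symm.toFun z) = z := by
  simpa using φ.symm.symm_toFun_toFun hz

theorem injOn_domain : Set.InjOn φ.toFun φ.domain := fun x hx y hy h => by
  rw [← φ.symm_toFun_toFun hx, h, φ.symm_toFun_toFun hy]

theorem countable_compl_domain : (φ.domainᶜ : Set ℂ).Countable := by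
  refine Set.Subsingleton.countable fun x hx y hy => ?_
  simp only [domain, Set.mem_compl_iff, Set.mem_ofPred_eq, not_not] at hx hy
  by_contra hxy
  have hc : φ.c = 0 := by
    have : φ.c * (x - y) = 0 := by linear_combination hx - hy
    exact (mul_eq_zero.1 this).resolve_right (sub_ne_zero.2 hxy)
  have hd : φ.d = 0 := by simpa [hc] using hx
  exact φ.det_ne_zero (by simp [hc, hd])

theorem eventually_mem_domain_cocountable : ∀ᶠ z in cocountable, z ∈ φ.domain :=
  mem_cocountable.2 φ.countable_compl_domain

theorem tendsto_cocountable : Tendsto φ.toFun cocountable cocountable := by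
  intro s hs
  rw [mem_cocountable] at hs
  rw [mem_map, mem_cocountable]
  have h1 : (φ.domain ∩ φ.toFun ⁻¹' sᶜ).Countable :=
    Set.MapsTo.countable_of_injOn (t := sᶜ) (fun z hz => hz.2)
      (φ.injOn_domain.mono Set.inter_subset_left) hs
  refine (φ.countable_compl_domain.union h1).mono fun z hz => ?_
  by_cases hzd : z ∈ φ.domain
  · exact Or.inr ⟨hzd, hz⟩
  · exact Or.inl hzd

theorem tendsto_nhdsNE (hz : z ∈ φ.domain) :
    Tendsto φ.toFun (𝓝[≠] z) (𝓝[≠] (φ.toFun z)) :=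
  (φ.hasDerivAt_toFun hz).tendsto_nhdsNE (φ.deriv₁_ne_zero hz)

/-- Partial fractions reduce the behaviour at the pole and at infinity to affine maps and inversion.
-/
theorem toFun_eq_add_inv (hc : φ.c ≠ 0) (hz : z ∈ φ.domain) :
    φ.toFun z = -(φ.a * φ.d - φ.b * φ.c) / φ.c * (φ.c * z + φ.d)⁻¹ + φ.a / φ.c := by
  have hz' : φ.c * z + φ.d ≠ 0 := hz
  rw [toFun, div_eq_iff hz', add_mul, mul_assoc, inv_mul_cancel₀ hz']
  field_simp
  ring

theorem tendsto_affine_cobounded {k : ℂ} (hk : k ≠ 0) (e : ℂ) :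
    Tendsto (fun z : ℂ => k * z + e) (Bornology.cobounded ℂ) (Bornology.cobounded ℂ) :=
  (tendsto_add_const_cobounded e).comp (tendsto_mul_left_cobounded hk)

theorem tendsto_affine_nhdsNE {k : ℂ} (hk : k ≠ 0) (e z : ℂ) :
    Tendsto (fun z : ℂ => k * z + e) (𝓝[≠] z) (𝓝[≠] (k * z + e)) := by
  have h : HasDerivAt (fun z : ℂ => k * z + e) k z := by
    simpa using ((hasDerivAt_id z).const_mul k).add_const e
  exact h.tendsto_nhdsNE hk

theorem tendsto_pole (hc : φ.c ≠ 0) (hz : z ∉ φ.domain) :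
    Tendsto φ.toFun (𝓝[≠] z) (Bornology.cobounded ℂ) := by
  have hz' : φ.c * z + φ.d = 0 := not_not.1 hz
  have hδ : -(φ.a * φ.d - φ.b * φ.c) / φ.c ≠ 0 := div_ne_zero (neg_ne_zero.2 φ.det_ne_zero) hc
  have h1 := tendsto_affine_nhdsNE hc φ.d z
  rw [hz'] at h1
  have h2 := (tendsto_affine_cobounded hδ (φ.a / φ.c)).comp (tendsto_inv₀_nhdsNE_zero.comp h1)
  refine h2.congr' ?_
  filter_upwards [h1 self_mem_nhdsWithin] with x hx
  exact (φ.toFun_eq_add_inv hc hx).symm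

theorem tendsto_infinity (hc : φ.c ≠ 0) :
    Tendsto φ.toFun (Bornology.cobounded ℂ ⊓ cocountable) (𝓝[≠] (φ.a / φ.c)) := by
  have hδ : -(φ.a * φ.d - φ.b * φ.c) / φ.c ≠ 0 := div_ne_zero (neg_ne_zero.2 φ.det_ne_zero) hc
  have h1 := tendsto_affine_nhdsNE hδ (φ.a / φ.c) 0
  rw [mul_zero, zero_add] at h1
  have h2 := h1.comp (tendsto_inv₀_cobounded'.comp (tendsto_affine_cobounded hc φ.d))
  refine (h2.mono_left inf_le_left).congr' ?_
  filter_upwards [mem_inf_of_right φ.eventually_mem_domain_cocountable] with x hx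
  exact (φ.toFun_eq_add_inv hc hx).symm

theorem tendsto_infinity_of_c_eq_zero (hc : φ.c = 0) :
    Tendsto φ.toFun (Bornology.cobounded ℂ) (Bornology.cobounded ℂ) := by
  have had : φ.a ≠ 0 ∧ φ.d ≠ 0 := by
    constructor <;> intro h <;> exact φ.det_ne_zero (by simp [hc, h])
  refine (tendsto_affine_cobounded (div_ne_zero had.1 had.2) (φ.b / φ.d)).congr fun z => ?_
  rw [toFun, hc]
  ring

end Moebius

/-! ### Transport of curves along a Möbius change of parameter. -/

theorem cocountable_le_codiscrete : (cocountable : Filter ℂ) ≤ codiscrete ℂ := fun _ hs =>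
  mem_cocountable.2 (countable_setOf_not hs)

instance nhdsNE_inf_cocountable_neBot (z : ℂ) : NeBot (𝓝[≠] z ⊓ cocountable) := by
  refine inf_neBot_iff.2 fun {s} hs {t} ht => ?_
  obtain ⟨x, -, hxt, hxs⟩ := exists_notMem_of_eventually (mem_cocountable.1 ht) hs
  exact ⟨x, hxs, not_not.1 hxt⟩

instance cocompact_inf_cocountable_neBot : NeBot (cocompact ℂ ⊓ (cocountable : Filter ℂ)) := by
  refine inf_neBot_iff.2 fun {s} hs {t} ht => ?_
  obtain ⟨K, hK, hKs⟩ := mem_cocompact.1 hs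
  obtain ⟨z, hz⟩ := (mem_cocompact.2 ⟨K, hK, subset_rfl⟩ : Kᶜ ∈ cocompact ℂ) |>
    (Filter.nonempty_of_mem ·)
  obtain ⟨x, -, hxt, hxs⟩ := exists_notMem_of_eventually (mem_cocountable.1 ht)
    (nhdsWithin_le_nhds (hK.isClosed.isOpen_compl.mem_nhds hz) : Kᶜ ∈ 𝓝[≠] z)
  exact ⟨x, hKs hxs, not_not.1 hxt⟩

/-- A limit along a filter with a basis of open sets may be computed off a countable set. -/
theorem tendsto_of_tendsto_inf_cocountable {X : Type*} [TopologicalSpace X] [RegularSpace X]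
    {p : ℂ → X} {B G : Filter ℂ} {x : X} (hB : ∀ s ∈ B, ∀ᶠ y in B, s ∈ 𝓝 y) (hGB : G ≤ B)
    (hc : ∀ᶠ y in G, ContinuousAt p y) (h : Tendsto p (B ⊓ cocountable) (𝓝 x)) :
    Tendsto p G (𝓝 x) := by
  refine (closed_nhds_basis x).tendsto_right_iff.2 fun V hV => ?_
  obtain ⟨s, hs, t, ht, hst⟩ := mem_inf_iff_superset.1 (h hV.1)
  filter_upwards [hc, hGB (hB s hs)] with y hy hsy
  by_contra hyV
  -- As `V` is closed, a bad value at a point of continuity persists nearby, hence also at points of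
  -- the cocountable set `t`.
  have h1 : ∀ᶠ y' in 𝓝 y, y' ∈ s ∧ p y' ∉ V :=
    (eventually_mem_set.2 hsy).and (hy.eventually (hV.2.isOpen_compl.mem_nhds hyV))
  obtain ⟨y', -, hyt, hys, hyV'⟩ := exists_notMem_of_eventually (mem_cocountable.1 ht)
    (h1.filter_mono nhdsWithin_le_nhds)
  exact hyV' (hst ⟨hys, not_not.1 hyt⟩)

theorem eventually_nhds_of_nhdsNE {z : ℂ} {P : ℂ → Prop} (h : ∀ᶠ x in 𝓝[≠] z, P x) :
    ∀ᶠ x in 𝓝[≠] z, ∀ᶠ y in 𝓝 x, P y := by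
  filter_upwards [eventually_eventually_nhdsWithin.2 h, self_mem_nhdsWithin] with x hx hxz
  rwa [isOpen_compl_singleton.nhdsWithin_eq hxz] at hx

section Curve

variable {p q : ℂ → Fin n → ℂ} {A : Matrix (Fin n) (Fin n) ℂ} {b : Fin n → ℂ}

theorem MeromorphicComponents.eventually_analyticAt (hp : MeromorphicComponents p) (z : ℂ) :
    ∀ᶠ x in 𝓝[≠] z, AnalyticAt ℂ p x := by
  have : ∀ᶠ x in 𝓝[≠] z, ∀ i, AnalyticAt ℂ (fun z => p z i) x :=
    eventually_all.2 fun i => (hp i z).eventually_analyticAt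
  exact this.mono fun x hx => analyticAt_pi_iff.2 hx

theorem MeromorphicComponents.eventually_analyticAt_codiscrete (hp : MeromorphicComponents p) :
    ∀ᶠ x in codiscrete ℂ, AnalyticAt ℂ p x :=
  eventually_codiscrete_iff.2 hp.eventually_analyticAt

/-- Unlike the filters in the definition of `curve`, `cocountable` is carried along by Möbius
transformations uniformly, without regard to the pole. -/
theorem mem_curve_iff (hp : MeromorphicComponents p) {x : Fin n → ℂ} :
    x ∈ curve p ↔ (∃ z, Tendsto p (𝓝[≠] z ⊓ cocountable) (𝓝 x)) ∨
      Tendsto p (cocompact ℂ ⊓ cocountable) (𝓝 x) := by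
  constructor
  · rintro (⟨z, hz⟩ | h)
    · exact Or.inl ⟨z, hz.mono_left inf_le_left⟩
    · exact Or.inr (h.mono_left (inf_le_inf_left _ cocountable_le_codiscrete))
  · rintro (⟨z, hz⟩ | h)
    · refine Or.inl ⟨z, tendsto_of_tendsto_inf_cocountable (fun s hs => ?_) le_rfl
        ((hp.eventually_analyticAt z).mono fun y hy => hy.continuousAt) hz⟩
      exact eventually_nhds_of_nhdsNE hs
    · refine Or.inr (tendsto_of_tendsto_inf_cocountable (fun s hs => ?_) inf_le_left
        (mem_inf_of_right (hp.eventually_analyticAt_codiscrete.mono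
          fun y hy => hy.continuousAt)) h)
      obtain ⟨K, hK, hKs⟩ := mem_cocompact.1 hs
      filter_upwards [hK.compl_mem_cocompact] with y hy
      exact mem_of_superset (hK.isClosed.isOpen_compl.mem_nhds hy) hKs

theorem continuous_affine (A : Matrix (Fin n) (Fin n) ℂ) (b : Fin n → ℂ) :
    Continuous fun x => A.mulVec x + b := by
  fun_prop

theorem eventually_symm {φ : Moebius}
    (h : ∀ᶠ z in cocountable, q (φ.toFun z) = A.mulVec (p z) + b) :
    ∀ᶠ w in cocountable, q w = A.mulVec (p (φ.symm.toFun w)) + b := by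
  filter_upwards [φ.symm.tendsto_cocountable.eventually h,
    φ.symm.eventually_mem_domain_cocountable] with w hw hwd
  rwa [φ.toFun_symm_toFun hwd] at hw

theorem image_curve_subset (hp : MeromorphicComponents p) (hq : MeromorphicComponents q)
    {φ : Moebius} (h : ∀ᶠ z in cocountable, q (φ.toFun z) = A.mulVec (p z) + b) :
    (fun x => A.mulVec x + b) '' curve p ⊆ curve q := by
  rintro _ ⟨x, hx, rfl⟩
  rw [mem_curve_iff hp] at hx
  rw [mem_curve_iff hq]
  set ψ := φ.symm with hψ
  -- Off a countable set `q = f ∘ p ∘ ψ`, so a limit of `p` along `G` becomes one of `q` along `B`.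
  -- The cases below are the finite or infinite positions of a point and its image.
  have key : ∀ {B G : Filter ℂ}, Tendsto ψ.toFun (B ⊓ cocountable) G →
      Tendsto p (G ⊓ cocountable) (𝓝 x) →
      Tendsto q (B ⊓ cocountable) (𝓝 (A.mulVec x + b)) := by
    intro B G hBG hpx
    have h1 : Tendsto ψ.toFun (B ⊓ cocountable) (G ⊓ cocountable) :=
      tendsto_inf.2 ⟨hBG, ψ.tendsto_cocountable.mono_left inf_le_right⟩
    refine (((continuous_affine A b).tendsto x).comp (hpx.comp h1)).congr' ?_
    filter_upwards [mem_inf_of_right (eventually_symm h)] with w hw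
    exact hw.symm
  have key' : ∀ {B G : Filter ℂ}, Tendsto ψ.toFun B G →
      Tendsto p (G ⊓ cocountable) (𝓝 x) →
      Tendsto q (B ⊓ cocountable) (𝓝 (A.mulVec x + b)) :=
    fun hBG => key (hBG.mono_left inf_le_left)
  rw [← Metric.cobounded_eq_cocompact] at hx ⊢
  rcases hx with ⟨z, hz⟩ | hx
  · by_cases hzd : z ∈ φ.domain
    · refine Or.inl ⟨φ.toFun z, key' (G := 𝓝[≠] z) ?_ hz⟩
      have := ψ.tendsto_nhdsNE (φ.toFun_mem_domain_symm hzd)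
      rwa [φ.symm_toFun_toFun hzd] at this
    · have hc : ψ.c ≠ 0 := by
        intro hc
        have hc' : φ.c = 0 := neg_eq_zero.1 hc
        have hd : φ.d = 0 := by
          have : φ.c * z + φ.d = 0 := not_not.1 hzd
          simpa [hc'] using this
        exact φ.det_ne_zero (by simp [hc', hd])
      refine Or.inr (key (G := 𝓝[≠] z) ?_ hz)
      have hz' : z = ψ.a / ψ.c := by
        rw [eq_div_iff hc]
        have : φ.c * z + φ.d = 0 := not_not.1 hzd
        change z * -φ.c = φ.d
        linear_combination -this
      rw [hz']
      exact ψ.tendsto_infinity hc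
  · by_cases hc : ψ.c = 0
    · exact Or.inr (key' (ψ.tendsto_infinity_of_c_eq_zero hc) hx)
    · refine Or.inl ⟨-ψ.d / ψ.c, key' (ψ.tendsto_pole hc ?_) hx⟩
      change ¬ (ψ.c * (-ψ.d / ψ.c) + ψ.d ≠ 0)
      rw [not_not, mul_div_cancel₀ _ hc, neg_add_cancel]

theorem inHyperplane_curve (hp : MeromorphicComponents p) {a : Fin n → ℂ} {c : ℂ} (ha : a ≠ 0)
    (h : ∀ᶠ z in cocountable, ∑ i, a i * p z i = c) : InHyperplane (curve p) := by
  refine ⟨a, c, ha, fun x hx => ?_⟩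
  have hcont : Continuous fun x : Fin n → ℂ => ∑ i, a i * x i := by fun_prop
  have key : ∀ B : Filter ℂ, NeBot (B ⊓ cocountable) →
      Tendsto p (B ⊓ cocountable) (𝓝 x) → ∑ i, a i * x i = c := by
    intro B _ hB
    refine tendsto_nhds_unique ((hcont.tendsto x).comp hB) (tendsto_const_nhds.congr' ?_)
    filter_upwards [mem_inf_of_right h] with z hz
    exact hz.symm
  rcases (mem_curve_iff hp).1 hx with ⟨z, hz⟩ | hx
  · exact key _ inferInstance hz
  · exact key _ inferInstance hx

/-- If `a ᵥ* A = 0` with `a ≠ 0`, then `a · q` is generically the constant `a · b`, contrary to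
`hqC`. Surjectivity is the inclusion of images for the inverse data. -/
theorem isAffineEquivalence_of_eventually (hp : MeromorphicComponents p)
    (hq : MeromorphicComponents q) (hqC : ¬ InHyperplane (curve q)) {φ : Moebius}
    (h : ∀ᶠ z in cocountable, q (φ.toFun z) = A.mulVec (p z) + b) :
    IsAffineEquivalence A b (curve p) (curve q) := by
  have h' := eventually_symm h
  have hA : A.det ≠ 0 := by
    intro hA
    obtain ⟨a, ha, haA⟩ := Matrix.exists_vecMul_eq_zero_iff.2 hA
    refine hqC (inHyperplane_curve hq (c := a ⬝ᵥ b) ha ?_)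
    filter_upwards [h'] with w hw
    change a ⬝ᵥ q w = a ⬝ᵥ b
    rw [hw, dotProduct_add, Matrix.dotProduct_mulVec, haA, zero_dotProduct, zero_add]
  refine ⟨hA, (image_curve_subset hp hq h).antisymm fun y hy => ?_⟩
  have hAA : A⁻¹ * A = 1 := Matrix.nonsing_inv_mul _ (isUnit_iff_ne_zero.2 hA)
  have hAA' : A * A⁻¹ = 1 := Matrix.mul_nonsing_inv _ (isUnit_iff_ne_zero.2 hA)
  have h2 : ∀ᶠ w in cocountable, p (φ.symm.toFun w) = A⁻¹.mulVec (q w) + -A⁻¹.mulVec b := by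
    filter_upwards [h'] with w hw
    rw [hw, Matrix.mulVec_add, Matrix.mulVec_mulVec, hAA, Matrix.one_mulVec,
      add_neg_cancel_right]
  refine ⟨_, image_curve_subset hq hp h2 ⟨y, hy, rfl⟩, ?_⟩
  simp only [Matrix.mulVec_add, Matrix.mulVec_neg, Matrix.mulVec_mulVec, hAA',
    Matrix.one_mulVec, neg_add_cancel_right]

end Curve

/-! ### The two implications. -/

theorem eventually_cocountable_of_codiscreteWithin (φ : Moebius) {P : ℂ → Prop}
    (h : ∀ᶠ z in codiscreteWithin φ.domain, P z) : ∀ᶠ z in cocountable, P z := by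
  have h1 : IsDiscrete ({z | ¬ P z} ∩ φ.domain) := by
    refine isDiscrete_of_codiscreteWithin ?_
    have : {x | ¬ P x}ᶜ = {x | P x} := by ext; simp
    rw [this]
    exact h
  refine mem_cocountable.2 ((φ.countable_compl_domain.union
    ((HereditarilyLindelofSpace.isLindelof _).countable_of_isDiscrete h1)).mono fun z hz => ?_)
  by_cases hzd : z ∈ φ.domain
  · exact Or.inr ⟨hz, hzd⟩
  · exact Or.inl hzd

theorem Matches.isAffineEquivalence {p q : ℂ → Fin n → ℂ} {A : Matrix (Fin n) (Fin n) ℂ}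
    {b : Fin n → ℂ} {φ : Moebius} (h : Matches p q φ A b) (hp : MeromorphicComponents p)
    (hq : MeromorphicComponents q) (hqC : ¬ InHyperplane (curve q)) :
    IsAffineEquivalence A b (curve p) (curve q) :=
  isAffineEquivalence_of_eventually hp hq hqC
    (eventually_cocountable_of_codiscreteWithin φ (h.2.2.mono fun _ hz => sub_eq_iff_eq_add'.1 hz))

theorem meromorphic_eval {u : ℂ → Fin n → ℂ} (hu : MeromorphicComponents u)
    (P : MvPolynomial (Fin n) ℂ) : Meromorphic (fun z => MvPolynomial.eval (u z) P) := by
  induction P using MvPolynomial.induction_on with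
  | C a => simpa using Meromorphic.const a
  | add P Q hP hQ => simpa using hP.fun_add hQ
  | mul_X P i hP => simpa using hP.fun_mul (hu i)

theorem MeromorphicComponents.affine {p : ℂ → Fin n → ℂ} (hp : MeromorphicComponents p)
    (A : Matrix (Fin n) (Fin n) ℂ) (b : Fin n → ℂ) :
    MeromorphicComponents (fun z => A.mulVec (p z) + b) := by
  intro i z
  simp only [Matrix.mulVec, dotProduct, Pi.add_apply]
  have := fun j => hp j z
  fun_prop

/-- All but countably many points of the curve are values at points of a given codiscrete set. -/
theorem exists_countable_curve_subset (q : ℂ → Fin n → ℂ) {G : ℂ → Prop}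
    (hG : ∀ᶠ w in codiscrete ℂ, G w) (hGc : ∀ w, G w → ContinuousAt q w) :
    ∃ T : Set (Fin n → ℂ), T.Countable ∧ ∀ x ∈ curve q, x ∉ T → ∃ w, G w ∧ q w = x := by
  have hne : NeBot (cocompact ℂ ⊓ codiscrete ℂ) :=
    cocompact_inf_cocountable_neBot.mono (inf_le_inf_left _ cocountable_le_codiscrete)
  -- Each of the countably many bad parameters, and infinity, contributes at most one limit.
  refine ⟨(⋃ w ∈ {w | ¬ G w}, {x | Tendsto q (𝓝[≠] w) (𝓝 x)}) ∪
    {x | Tendsto q (cocompact ℂ ⊓ codiscrete ℂ) (𝓝 x)}, ?_, ?_⟩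
  · refine ((countable_setOf_not hG).biUnion fun w _ => ?_).union ?_
    · exact Set.Subsingleton.countable fun x hx y hy => tendsto_nhds_unique hx hy
    · exact Set.Subsingleton.countable fun x hx y hy => tendsto_nhds_unique hx hy
  · rintro x (⟨w, hw⟩ | hx) hxT
    · by_cases hGw : G w
      · exact ⟨w, hGw, tendsto_nhds_unique ((hGc w hGw).tendsto.mono_left nhdsWithin_le_nhds) hw⟩
      · exact absurd (Or.inl (Set.mem_biUnion hGw hw)) hxT
    · exact absurd (Or.inr hx) hxT

theorem exists_moebius_of_affinelyEquivalent {p q : ℂ → Fin n → ℂ}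
    (hp : MeromorphicComponents p) (hq : MeromorphicComponents q)
    (hpinv : HasRationalInverse p) (hqinv : HasRationalInverse q)
    {A : Matrix (Fin n) (Fin n) ℂ} {b : Fin n → ℂ}
    (h : IsAffineEquivalence A b (curve p) (curve q)) :
    ∃ φ : Moebius, ∀ᶠ z in cocountable, q (φ.toFun z) = A.mulVec (p z) + b := by
  obtain ⟨R, S, hRS⟩ := hpinv
  obtain ⟨R', S', hRS'⟩ := hqinv
  have hfinj : Function.Injective fun x => A.mulVec x + b := fun x y hxy =>
    Matrix.mulVec_injective_of_isUnit ((Matrix.isUnit_iff_isUnit_det _).2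
      (isUnit_iff_ne_zero.2 h.1)) (add_right_cancel hxy)
  set Gp : ℂ → Prop := fun z => AnalyticAt ℂ p z ∧
    MvPolynomial.eval (p z) R / MvPolynomial.eval (p z) S = z with hGp
  set Gq : ℂ → Prop := fun z => AnalyticAt ℂ q z ∧
    MvPolynomial.eval (q z) R' / MvPolynomial.eval (q z) S' = z with hGq
  have hGpe : ∀ᶠ z in codiscrete ℂ, Gp z :=
    hp.eventually_analyticAt_codiscrete.and (hRS.mono fun z hz => hz.2)
  have hGqe : ∀ᶠ z in codiscrete ℂ, Gq z :=
    hq.eventually_analyticAt_codiscrete.and (hRS'.mono fun z hz => hz.2)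
  obtain ⟨T, hT, hTq⟩ := exists_countable_curve_subset q hGqe fun w hw => hw.1.continuousAt
  set f : ℂ → Fin n → ℂ := fun z => A.mulVec (p z) + b with hf
  set ψ : ℂ → ℂ := fun z => MvPolynomial.eval (f z) R' / MvPolynomial.eval (f z) S' with hψ
  have hψm : Meromorphic ψ :=
    (meromorphic_eval (hp.affine A b) R').fun_div (meromorphic_eval (hp.affine A b) S')
  have hfi : Set.InjOn f {z | Gp z} := by
    intro x hx y hy hxy
    have : p x = p y := hfinj hxy
    rw [← hx.2, this, hy.2]
  -- Besides irregular parameters, discard those mapped by `f` into the exceptional set `T` of `C₂`;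
  -- they are countable because `f` is injective on `Gp`.
  set N : Set ℂ := {z | ¬ Gp z} ∪ {z | Gp z ∧ f z ∈ T} with hN
  have hNc : N.Countable := (countable_setOf_not hGpe).union
    (Set.MapsTo.countable_of_injOn (t := T) (fun z hz => hz.2) (hfi.mono fun z hz => hz.1) hT)
  have hNG : ∀ z ∉ N, Gp z := fun z hz => by
    by_contra h
    exact hz (Or.inl h)
  have hcomp : ∀ z ∉ N, q (ψ z) = f z := by
    intro z hz
    have hGz := hNG z hz
    have hmem : f z ∈ curve q := by
      rw [← h.2]
      exact ⟨p z, Or.inl ⟨z, hGz.1.continuousAt.tendsto.mono_left nhdsWithin_le_nhds⟩, rfl⟩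
    obtain ⟨w, hw, hqw⟩ := hTq _ hmem fun hT => hz (Or.inr ⟨hGz, hT⟩)
    have : ψ z = w := by
      simp only [hψ, ← hqw]
      exact hw.2
    rw [this, hqw]
  have hinj : Set.InjOn ψ Nᶜ := by
    intro x hx y hy hxy
    refine hfi (hNG x hx) (hNG y hy) ?_
    rw [← hcomp x hx, hxy, hcomp y hy]
  obtain ⟨φ, N', hN', hφ⟩ := exists_moebius_of_injOn hψm hNc hinj
  refine ⟨φ, mem_cocountable.2 ((hNc.union hN').mono fun z hz => ?_)⟩
  by_contra hcon
  rw [Set.mem_union, not_or] at hcon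
  refine hz ?_
  change q (φ.toFun z) = f z
  rw [← (hφ z hcon.2).2, hcomp z hcon.1]

/-- Meromorphic functions that agree frequently near a point agree on a punctured neighbourhood of
it. -/
theorem eventually_of_cocountable {p q : ℂ → Fin n → ℂ}
    (hp : MeromorphicComponents p) (hq : MeromorphicComponents q)
    {A : Matrix (Fin n) (Fin n) ℂ} {b : Fin n → ℂ} {φ : Moebius}
    (h : ∀ᶠ z in cocountable, q (φ.toFun z) = A.mulVec (p z) + b) {z : ℂ} (hz : z ∈ φ.domain) :
    ∀ᶠ x in 𝓝[≠] z, q (φ.toFun x) = A.mulVec (p x) + b := by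
  have hi : ∀ i, ∀ᶠ x in 𝓝[≠] z, q (φ.toFun x) i = (A.mulVec (p x) + b) i := by
    intro i
    have h1 : MeromorphicAt (fun x => q (φ.toFun x) i) z :=
      (hq i (φ.toFun z)).comp_analyticAt (φ.analyticAt_toFun hz)
    refine (h1.frequently_eq_iff_eventuallyEq (hp.affine A b i z)).1 ?_
    refine (frequently_notMem_of_countable (mem_cocountable.1 h) z).mono fun x hx => ?_
    have : q (φ.toFun x) = A.mulVec (p x) + b := not_not.1 hx
    rw [this]
  exact (eventually_all.2 hi).mono fun x hx => funext hx

/-- A meromorphic function which vanishes near one point vanishes near all points. -/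
theorem eventually_eq_zero_of_eventually_eq_zero {g : ℂ → ℂ} (hg : Meromorphic g) {z : ℂ}
    (h : ∀ᶠ x in 𝓝[≠] z, g x = 0) : ∀ᶠ x in codiscrete ℂ, g x = 0 := by
  refine eventually_codiscrete_iff.2 fun w => ?_
  rw [← meromorphicOrderAt_eq_top_iff] at h ⊢
  by_contra hw
  exact hg.exists_meromorphicOrderAt_ne_top_iff_forall.1 ⟨w, hw⟩ z h

theorem meromorphicAt_det {k : ℕ} {C : ℂ → Matrix (Fin k) (Fin k) ℂ} {z : ℂ}
    (hC : ∀ i j, MeromorphicAt (fun x => C x i j) z) : MeromorphicAt (fun x => (C x).det) z := by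
  simp only [Matrix.det_apply']
  refine MeromorphicAt.fun_sum fun σ _ => ?_
  exact (MeromorphicAt.const _ _).fun_mul (MeromorphicAt.fun_prod fun i _ => hC _ _)

theorem meromorphicAt_delta {p : ℂ → Fin n → ℂ} (hp : MeromorphicComponents p) (z : ℂ) :
    MeromorphicAt (Delta p) z := by
  -- Componentwise derivatives are meromorphic; they agree with those of the vector function
  -- wherever `p` is analytic.
  have h1 : MeromorphicAt (fun x => (Matrix.of fun r j : Fin n =>
      iteratedDeriv ((j : ℕ) + 1) (fun y => p y r) x).det) z := by
    refine meromorphicAt_det fun i j => ?_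
    simp only [Matrix.of_apply, iteratedDeriv_eq_iterate]
    exact (hp i z).iterated_deriv
  refine h1.congr ?_
  filter_upwards [hp.eventually_analyticAt z] with x hx
  simp only [Delta, D, derivMatrix]
  congr 1
  ext r j
  exact iteratedDeriv_clm_comp hx
    (ContinuousLinearMap.proj (R := ℂ) (φ := fun _ : Fin n => ℂ) r) ((j : ℕ) + 1)

/-- `Delta p` is the Wronskian of `p'`. If it vanished near a point, some `a · p'` would vanish on a
disc, and `a · p` would be constant there and, by the identity theorem, generically. -/
theorem eventually_delta_ne_zero {p : ℂ → Fin n → ℂ} (hp : MeromorphicComponents p)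
    (hpC : ¬ InHyperplane (curve p)) (z : ℂ) : ∀ᶠ x in 𝓝[≠] z, Delta p x ≠ 0 := by
  refine (meromorphicAt_delta hp z).eventually_eq_zero_or_eventually_ne_zero.resolve_left
    fun h0 => hpC ?_
  obtain ⟨x₀, -, -, hx₀⟩ := exists_notMem_of_eventually Set.countable_empty
    ((eventually_nhds_of_nhdsNE h0).and (eventually_nhds_of_nhdsNE (hp.eventually_analyticAt z)))
  obtain ⟨ε, hε, hball⟩ := Metric.eventually_nhds_iff_ball.1 (hx₀.1.and hx₀.2)
  obtain ⟨a, ha, z₁, hz₁, hza⟩ := exists_dotProduct_eq_zero_of_wronskian (w := deriv p)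
    Metric.isOpen_ball ⟨x₀, Metric.mem_ball_self hε⟩ (fun x hx => (hball x hx).2.deriv)
    (fun x hx => by
      have := (hball x hx).1
      simpa only [Delta, D, derivMatrix, iteratedDeriv_succ'] using this)
  let ℓ : (Fin n → ℂ) →L[ℂ] ℂ :=
    ∑ i, a i • ContinuousLinearMap.proj (R := ℂ) (φ := fun _ : Fin n => ℂ) i
  have hℓ : ∀ x, ℓ x = ∑ i, a i * x i := by
    intro x
    simp [ℓ]
  obtain ⟨δ, hδ, hball'⟩ := Metric.eventually_nhds_iff_ball.1
    (hza.and (Metric.isOpen_ball.mem_nhds hz₁))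
  have hder : ∀ x ∈ Metric.ball z₁ δ, HasDerivAt (fun x => ∑ i, a i * p x i) 0 x := by
    intro x hx
    simp only [← hℓ]
    have h1 := ℓ.hasFDerivAt.comp_hasDerivAt x
      (hball x (hball' x hx).2).2.differentiableAt.hasDerivAt
    rwa [hℓ, (hball' x hx).1] at h1
  have hconst : ∀ x ∈ Metric.ball z₁ δ, ∑ i, a i * p x i = ∑ i, a i * p z₁ i := fun x hx =>
    Metric.isOpen_ball.is_const_of_deriv_eq_zero (convex_ball z₁ δ).isPreconnected
      (fun y hy => (hder y hy).differentiableAt.differentiableWithinAt)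
      (fun y hy => (hder y hy).deriv) hx (Metric.mem_ball_self hδ)
  have hmer : Meromorphic fun x => ∑ i, a i * p x i - ∑ i, a i * p z₁ i := by
    intro x
    have := fun i => hp i x
    fun_prop
  refine inHyperplane_curve hp (c := ∑ i, a i * p z₁ i) ha ?_
  have h2 := eventually_eq_zero_of_eventually_eq_zero hmer (z := z₁) (nhdsWithin_le_nhds (by
    filter_upwards [Metric.ball_mem_nhds z₁ hδ] with x hx
    rw [hconst x hx, sub_self]))
  exact cocountable_le_codiscrete (h2.mono fun x hx => sub_eq_zero.1 hx)

/-- At generic points, `F_j(p) = F_j(q ∘ φ)` by affine invariance and `F_j(q ∘ φ) = F_j(q) ∘ φ` by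
the Lah relations. -/
theorem matches_of_eventually {p q : ℂ → Fin n → ℂ}
    (hp : MeromorphicComponents p) (hq : MeromorphicComponents q)
    (hpC : ¬ InHyperplane (curve p))
    {A : Matrix (Fin n) (Fin n) ℂ} {b : Fin n → ℂ} (hA : A.det ≠ 0) {φ : Moebius}
    (h : ∀ᶠ z in cocountable, q (φ.toFun z) = A.mulVec (p z) + b) : Matches p q φ A b := by
  have hrel : ∀ z ∈ φ.domain, ∀ᶠ x in 𝓝[≠] z, q (φ.toFun x) = A.mulVec (p x) + b :=
    fun z hz => eventually_of_cocountable hp hq h hz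
  have hgen : ∀ z ∈ φ.domain, ∀ᶠ x in 𝓝[≠] z, x ∈ φ.domain ∧ Delta p x ≠ 0 ∧
      AnalyticAt ℂ q (φ.toFun x) ∧ ∀ k, iteratedDeriv (k + 1) (fun y => q (φ.toFun y)) x
        = A.mulVec (iteratedDeriv (k + 1) p x) := by
    intro z hz
    filter_upwards [nhdsWithin_le_nhds (φ.eventually_mem_domain hz),
      eventually_delta_ne_zero hp hpC z,
      (φ.tendsto_nhdsNE hz).eventually (hq.eventually_analyticAt (φ.toFun z)),
      hp.eventually_analyticAt z, eventually_nhds_of_nhdsNE (hrel z hz)] with x h1 h2 h3 h4 h5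
    exact ⟨h1, h2, h3, iteratedDeriv_affine h4 h5⟩
  refine ⟨fun j hj => ?_, ?_, ?_⟩
  · rw [eventually_codiscreteWithin_iff φ.isOpen_domain]
    intro z hz
    filter_upwards [hgen z hz] with x ⟨hx, hΔ, hqx, hder⟩
    have hlah := φ.lahRelated_comp q hx hqx
    have hl := φ.deriv₁_ne_zero hx
    have hΔ' : Delta q (φ.toFun x) ≠ 0 := by
      rw [← hlah.delta_ne_zero_iff hl, Delta, D_affine hder, Matrix.det_mul]
      exact mul_ne_zero hA hΔ
    have hn : 2 ≤ n := by
      rw [Finset.mem_Icc] at hj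
      omega
    constructor
    · rw [← den_affine hder hA, hlah.den_eq hl hΔ' hn, mul_eq_zero]
      exact or_iff_right (pow_ne_zero 2 hl)
    · rw [← F_affine hder hA, hlah.F_eq hl hΔ' hj]
  · rw [eventually_codiscreteWithin_iff φ.isOpen_domain]
    intro z hz
    filter_upwards [hgen z hz] with x ⟨_, hΔ, _, hder⟩
    rw [D_affine hder, Matrix.mul_assoc, Matrix.mul_nonsing_inv _ (isUnit_iff_ne_zero.2 hΔ),
      Matrix.mul_one]
  · rw [eventually_codiscreteWithin_iff φ.isOpen_domain]
    intro z hz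
    filter_upwards [hrel z hz] with x hx
    rw [hx, add_sub_cancel_left]

end AffineCurves

end

theorem mainTheorem3 {n : ℕ} (p q : ℂ → Fin n → ℂ)
    (hp : AffineCurves.MeromorphicComponents p) (hq : AffineCurves.MeromorphicComponents q)
    (hpinv : AffineCurves.HasRationalInverse p) (hqinv : AffineCurves.HasRationalInverse q)
    (hpC : ¬ AffineCurves.InHyperplane (AffineCurves.curve p))
    (hqC : ¬ AffineCurves.InHyperplane (AffineCurves.curve q)) :
    (AffineCurves.AffinelyEquivalent (AffineCurves.curve p) (AffineCurves.curve q) ↔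
      ∃ (φ : AffineCurves.Moebius) (A : Matrix (Fin n) (Fin n) ℂ) (b : Fin n → ℂ),
        AffineCurves.Matches p q φ A b) ∧
    ∀ (φ : AffineCurves.Moebius) (A : Matrix (Fin n) (Fin n) ℂ) (b : Fin n → ℂ),
      AffineCurves.Matches p q φ A b →
        AffineCurves.IsAffineEquivalence A b (AffineCurves.curve p) (AffineCurves.curve q) := by
  refine ⟨⟨fun ⟨A, b, h⟩ => ?_, fun ⟨φ, A, b, h⟩ => ⟨A, b, h.isAffineEquivalence hp hq hqC⟩⟩,
    fun φ A b h => h.isAffineEquivalence hp hq hqC⟩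
  obtain ⟨φ, hφ⟩ := AffineCurves.exists_moebius_of_affinelyEquivalent hp hq hpinv hqinv h
  exact ⟨φ, A, b, AffineCurves.matches_of_eventually hp hq hpC h.1 hφ⟩
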